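/- Fix $\epsilon\in[0,\tfrac12)$. A single broadcast link connects $n$ parties. In a fully utilized protocol with $R$ rounds, in every round every party $i$ broadcasts exactly one bit, which is a function of its input $x_i$ and of all the bits it has received in the previous rounds from the other $n-1$ parties; the number of rounds is fixed in advance. If the link is noiseless, every other party receives the broadcast bit. If the link is $\epsilon$-noisy, then each copy of a broadcast bit received by another party is flipped with probability $\epsilon$, independently across rounds, senders and receivers. There are a constant $C$ and a sequence $\delta_n\to 0$ as $n\to\infty$, both depending only on $\epsilon$, such that the following holds for all $n\ge 3$, all $R\ge 0$ and every fully utilized noiseless protocol $\pi$ with $R$ rounds on a single broadcast link with $n$ parties. There is a fully utilized protocol $\Pi$ on the $\epsilon$-noisy link with at most $C\cdot R\cdot\log\log n$ rounds, at the end of which each party computes an output from its input and the bits it received, such that for every choice of the parties' inputs, with probability at least $1-\delta_n$, every party outputs exactly the sequence of bits it sends and the sequence of bits it receives in the noiseless execution of $\pi$ on these inputs. -/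

import Mathlib

open Filter Topology MeasureTheory ProbabilityTheory

universe u

namespace BroadcastLink

/-- A received transcript of length `r` of party `i` on a single broadcast link with `n` parties:
in every round, one bit from each of the other `n - 1` parties. -/
abbrev Transcript (n : ℕ) (i : Fin n) (r : ℕ) : Type :=
  Fin r → {j : Fin n // j ≠ i} → Bool

/-- A fully utilized protocol with `R` rounds on a single broadcast link with `n` parties, where
party `i` has an input in `X i`. In every round every party broadcasts exactly one bit, which is a
function of its input and of the transcript that it received in the previous rounds.
The number of rounds is fixed, and does not depend on inputs or received bits. -/
structure Protocol {n : ℕ} (X : Fin n → Type u) (R : ℕ) where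
  /-- `bit i a r m` is what party `i` broadcasts in round `r` on input `a`, having received `m`. -/
  bit : (i : Fin n) → X i → (r : Fin R) → Transcript n i r → Bool

/-- Ordered pairs (sender, receiver) of distinct parties. -/
abbrev Link (n : ℕ) : Type := {l : Fin n × Fin n // l.1 ≠ l.2}

/-- A noise pattern for `R` rounds: which copies are flipped, by round, sender and receiver. -/
abbrev Noise (n R : ℕ) : Type := Fin R × Link n → Bool

/-- The law of the noise of the `ε`-noisy broadcast link: each copy, of each bit, at each
receiver, is flipped with probability `ε`, independently over rounds, senders and receivers. -/
noncomputable def noiseLaw (n R : ℕ) (ε : unitInterval) : Measure (Noise n R) :=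
  Measure.pi fun _ => bernoulliMeasure true false ε

namespace Protocol

variable {n : ℕ} {X : Fin n → Type u} {R : ℕ}

/-- The bit that party `i` broadcasts in round `r`, on inputs `x` and noise pattern `e`.
In round `s`, party `i` receives from `j` the bit sent by `j` xor the noise bit of that copy. -/
def sent (P : Protocol X R) (x : ∀ i, X i) (e : Noise n R) (r : Fin R) (i : Fin n) : Bool :=
  P.bit i (x i) r fun s j =>
    xor (sent P x e ⟨s, s.2.trans r.2⟩ j) (e (⟨s, s.2.trans r.2⟩, ⟨(j, i), j.2⟩))
termination_by (r : ℕ)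
decreasing_by exact s.2

/-- The transcript of all `R` rounds received by party `i`. -/
def received (P : Protocol X R) (x : ∀ i, X i) (e : Noise n R) (i : Fin n) : Transcript n i R :=
  fun r j => xor (P.sent x e r j) (e (r, ⟨(j, i), j.2⟩))

/-- The sent transcript of party `i` in the noiseless execution. -/
def sentTranscript (P : Protocol X R) (x : ∀ i, X i) (i : Fin n) : Fin R → Bool :=
  fun r => P.sent x (fun _ => false) r i

/-- The received transcript of party `i` in the noiseless execution. -/
def receivedTranscript (P : Protocol X R) (x : ∀ i, X i) (i : Fin n) : Transcript n i R :=
  P.received x (fun _ => false) i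

end Protocol

/-- A fully utilized `T`-round simulation of `R`-round protocols with inputs in `X`: a fully
utilized protocol with `T` rounds, after which each party computes, from its input and the
transcript that it received, an estimate of its sent and received transcripts in the original
protocol. -/
structure Simulation {n : ℕ} (X : Fin n → Type u) (R T : ℕ) extends Protocol X T where
  output : (i : Fin n) → X i → Transcript n i T → (Fin R → Bool) × Transcript n i R

/-- The simulation `S` of `P` succeeds on inputs `x` and noise pattern `e`: every party outputs the
transcripts that it sends and receives in the noiseless execution of `P`. -/
def Simulation.Succeeds {n : ℕ} {X : Fin n → Type u} {R T : ℕ} (S : Simulation X R T)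
    (P : Protocol X R) (x : ∀ i, X i) (e : Noise n T) : Prop :=
  ∀ i, S.output i (x i) (S.received x e i) = (P.sentTranscript x i, P.receivedTranscript x i)

end BroadcastLink

/-! The simulation is the composition of two layers.

The outer layer tolerates arbitrary noise confined to a small constant fraction of its rounds. In
each of `2 * R` time steps every party sends either the next bit of `P` or a demand to back up,
encoded by a tree code whose labels have constantly many bits `s`. Decoded histories drive a stack
of simulated rounds. A step in which all parties decode correctly raises the number of correct minus
incorrect entries by one, any other step lowers it by at most one, and the tree code charges the
latter steps to noisy times. Hence `R` correct rounds survive if at most `R / 16` rounds are noisy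
(`robustSim_succeeds`).

The inner layer, Gallager's protocol, replaces one noiseless round by `O(log log n)` noisy ones. The
parties are split into groups of about `log n`. Repeating a bit `O(log log n)` times makes a wrong
majority less likely than any fixed multiple of `1 / log n`. Each party learns the bits of its
group, and then sends, with the same repetition, only its own symbol of a constant-rate code for
that word. A receiver errs about a group only if a constant fraction of the senders is bad. For a
fixed receiver the senders are bad independently, so this has probability exponentially small in
`log n`, and a union bound gives failure probability at most `n⁻¹⁶` (`exists_reliable_gadget`).

Failures of different runs of the inner layer are independent, and a run that fails acts as one
noisy round of the outer layer. With `M = 2 * R * s` runs, more than `R / 16` failures have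
probability at most `2 ^ M * n ^ (-16 * (R / 16 + 1)) ≤ 4 ^ (s * R) * n ^ (-(R + 1))`, which is at
most `1 / n` once `4 ^ s ≤ n`. -/

namespace BroadcastLink

/-! ### Tree codes over a constant alphabet, from convolutions over a finite field -/

section TreeCode

variable {F : Type*} [Field F]

/-- The `t`-th symbol of the convolution of `α` and `z`. -/
def conv (α z : ℕ → F) (t : ℕ) : F := ∑ i ∈ Finset.range (t + 1), α (t - i) * z i

lemma conv_congr {α β z w : ℕ → F} {t : ℕ} (hα : ∀ i ≤ t, α i = β i) (hz : ∀ i ≤ t, z i = w i) :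
    conv α z t = conv β w t := by
  refine Finset.sum_congr rfl fun i hi => ?_
  have : i ≤ t := by simpa [Nat.lt_succ_iff] using hi
  rw [hα _ (Nat.sub_le _ _), hz _ this]

lemma conv_sub (α z w : ℕ → F) (t : ℕ) :
    conv α (fun i => z i - w i) t = conv α z t - conv α w t := by
  simp [conv, mul_sub, Finset.sum_sub_distrib]

/-- The kernel depends only on `t - i`. Together with linearity this reduces the distance of two
messages that part at time `d` to the zeros of one convolution that starts at time `0`. -/
lemma conv_shift {α z : ℕ → F} {d : ℕ} (hz : ∀ i < d, z i = 0) (u : ℕ) :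
    conv α z (d + u) = conv α (fun i => z (d + i)) u := by
  unfold conv
  rw [show d + u + 1 = d + (u + 1) by ring, Finset.sum_range_add]
  rw [Finset.sum_eq_zero (fun i hi => by rw [hz i (Finset.mem_range.1 hi), mul_zero]), zero_add]
  refine Finset.sum_congr rfl fun i _ => ?_
  rw [Nat.add_sub_add_left]

lemma conv_update_left (α z : ℕ → F) (k : ℕ) (a : F) :
    conv (Function.update α (k + 1) a) z (k + 1) =
      a * z 0 + ∑ i ∈ Finset.range (k + 1), α (k - i) * z (i + 1) := by
  unfold conv
  rw [Finset.sum_range_succ']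
  simp only [Nat.sub_zero, Function.update_self]
  rw [add_comm]
  congr 1
  refine Finset.sum_congr rfl fun i hi => ?_
  rw [Function.update_of_ne (by omega), Nat.add_sub_add_right]

open scoped Classical

/-- The sequences of length `k + 1` with entries in `Z` and a nonzero first entry. -/
noncomputable def seqs (Z : Finset F) : ℕ → Finset (ℕ → F)
  | 0 => (Z.erase 0).image fun d => Function.update 0 0 d
  | k + 1 => (seqs Z k ×ˢ Z).image fun p => Function.update p.1 (k + 1) p.2

lemma seqs_zero_ne {Z : Finset F} {k : ℕ} {z : ℕ → F} (hz : z ∈ seqs Z k) : z 0 ≠ 0 := by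
  induction k generalizing z with
  | zero =>
    obtain ⟨d, hd, rfl⟩ := Finset.mem_image.1 hz
    simpa using (Finset.mem_erase.1 hd).1
  | succ k ih =>
    obtain ⟨p, hp, rfl⟩ := Finset.mem_image.1 hz
    rw [Function.update_of_ne (by omega)]
    exact ih (Finset.mem_product.1 hp).1

lemma exists_mem_seqs {Z : Finset F} {z : ℕ → F} (hz : ∀ i, z i ∈ Z) (h0 : z 0 ≠ 0) (k : ℕ) :
    ∃ w ∈ seqs Z k, ∀ i ≤ k, w i = z i := by
  induction k with
  | zero =>
    refine ⟨_, Finset.mem_image_of_mem _ (Finset.mem_erase.2 ⟨h0, hz 0⟩), fun i hi => ?_⟩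
    obtain rfl : i = 0 := by omega
    simp
  | succ k ih =>
    obtain ⟨w, hw, h⟩ := ih
    refine ⟨_, Finset.mem_image_of_mem _ (Finset.mk_mem_product hw (hz (k + 1))), fun i hi => ?_⟩
    rcases eq_or_ne i (k + 1) with rfl | hne
    · simp
    · rw [Function.update_of_ne hne]
      exact h i (by omega)

/-- The number of zeros among the first `l` symbols of a convolution. -/
noncomputable def zeroCount (α z : ℕ → F) (l : ℕ) : ℕ :=
  ((Finset.range l).filter fun u => conv α z u = 0).card

lemma zeroCount_congr {α β z w : ℕ → F} {l : ℕ} (hα : ∀ i < l, α i = β i)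
    (hz : ∀ i < l, z i = w i) : zeroCount α z l = zeroCount β w l := by
  unfold zeroCount
  congr 1
  refine Finset.filter_congr fun u hu => ?_
  have hu := Finset.mem_range.1 hu
  rw [conv_congr (fun i hi => hα i (by omega)) (fun i hi => hz i (by omega))]

lemma zeroCount_succ (α z : ℕ → F) (l : ℕ) :
    zeroCount α z (l + 1) = zeroCount α z l + if conv α z l = 0 then 1 else 0 := by
  unfold zeroCount
  rw [Finset.range_add_one, Finset.filter_insert]
  split_ifs with h
  · rw [Finset.card_insert_of_notMem (by simp)]
  · rfl

variable [Fintype F]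

/-- The potential that guides the greedy choice of the coefficients of the code. -/
noncomputable def seqPotential (Z : Finset F) (α : ℕ → F) (k : ℕ) : ℕ :=
  ∑ z ∈ seqs Z k, Fintype.card F ^ zeroCount α z (k + 1)

lemma seqPotential_congr {Z : Finset F} {α β : ℕ → F} {k : ℕ} (h : ∀ i ≤ k, α i = β i) :
    seqPotential Z α k = seqPotential Z β k := by
  refine Finset.sum_congr rfl fun z _ => ?_
  rw [zeroCount_congr (fun i hi => h i (by omega)) fun _ _ => rfl]

/-- The affine map has exactly one root, which contributes `Fintype.card F`, and every other `a`
contributes `1`. -/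
lemma sum_pow_affine_le {b c : F} (hb : b ≠ 0) :
    ∑ a : F, Fintype.card F ^ (if a * b + c = 0 then 1 else 0) ≤ Fintype.card F * 2 := by
  have h : ∀ a : F, Fintype.card F ^ (if a * b + c = 0 then 1 else 0) ≤
      1 + if a = -c / b then Fintype.card F else 0 := by
    intro a
    have : a * b + c = 0 ↔ a = -c / b := by
      rw [eq_div_iff hb, add_eq_zero_iff_eq_neg]
    simp only [this]
    split_ifs <;> simp
  refine (Finset.sum_le_sum fun a _ => h a).trans ?_
  simp [Finset.sum_add_distrib, mul_two]

/-- The new coefficient `a` meets only `z 0 ≠ 0` in symbol `k + 1`, so this symbol is uniform for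
uniform `a`. On average the weight of a sequence at most doubles, and each sequence has at most
`Z.card` extensions. -/
lemma sum_seqPotential_le (Z : Finset F) (α : ℕ → F) (k : ℕ) :
    ∑ a : F, seqPotential Z (Function.update α (k + 1) a) (k + 1) ≤
      Fintype.card F * (2 * Z.card * seqPotential Z α k) := by
  have key : ∀ a : F, seqPotential Z (Function.update α (k + 1) a) (k + 1) ≤
      ∑ z ∈ seqs Z k, ∑ d ∈ Z, Fintype.card F ^ zeroCount α z (k + 1) *
        Fintype.card F ^ (if a * z 0 + ∑ i ∈ Finset.range (k + 1), α (k - i) *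
          (Function.update z (k + 1) d) (i + 1) = 0 then 1 else 0) := by
    intro a
    rw [← Finset.sum_product']
    unfold seqPotential
    rw [seqs]
    refine (Finset.sum_image_le_of_nonneg fun _ _ => Nat.zero_le _).trans (le_of_eq ?_)
    refine Finset.sum_congr rfl fun p _ => ?_
    rw [zeroCount_succ, conv_update_left, pow_add, Function.update_of_ne (by omega)]
    congr 2
    refine zeroCount_congr (fun i hi => ?_) (fun i hi => ?_) <;>
      rw [Function.update_of_ne (by omega)]
  refine (Finset.sum_le_sum fun a _ => key a).trans ?_
  rw [Finset.sum_comm]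
  unfold seqPotential
  rw [Finset.mul_sum, Finset.mul_sum]
  refine Finset.sum_le_sum fun z hz => ?_
  rw [Finset.sum_comm]
  refine (Finset.sum_le_card_nsmul _ _ (Fintype.card F ^ zeroCount α z (k + 1) *
    (Fintype.card F * 2)) fun d _ => ?_).trans (le_of_eq ?_)
  · rw [← Finset.mul_sum]
    exact Nat.mul_le_mul_left _ (sum_pow_affine_le (seqs_zero_ne hz))
  · rw [smul_eq_mul]; ring

lemma exists_seqPotential_le (Z : Finset F) (k : ℕ) :
    ∃ α : ℕ → F, ∀ j ≤ k, seqPotential Z α j ≤ (2 * Z.card) ^ (j + 1) := by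
  induction k with
  | zero =>
    refine ⟨fun _ => 1, fun j hj => ?_⟩
    obtain rfl : j = 0 := by omega
    have : ∀ z ∈ seqs Z 0, Fintype.card F ^ zeroCount (fun _ => 1) z (0 + 1) ≤ 1 := by
      intro z hz
      have h0 := seqs_zero_ne hz
      rw [zeroCount_succ]
      simp [zeroCount, conv, h0]
    refine (Finset.sum_le_card_nsmul _ _ _ this).trans ?_
    have h1 : (seqs Z 0).card ≤ Z.card := Finset.card_image_le.trans (Finset.card_erase_le)
    simp only [smul_eq_mul, mul_one, zero_add, pow_one]
    omega
  | succ k ih =>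
    obtain ⟨α, hα⟩ := ih
    have hsum : ∑ a : F, seqPotential Z (Function.update α (k + 1) a) (k + 1) ≤
        ∑ _a : F, (2 * Z.card) ^ (k + 2) := by
      refine (sum_seqPotential_le Z α k).trans ?_
      rw [Finset.sum_const, smul_eq_mul, Finset.card_univ, pow_succ' _ (k + 1)]
      gcongr
      exact hα k le_rfl
    obtain ⟨a, -, ha⟩ := Finset.exists_le_of_sum_le Finset.univ_nonempty hsum
    refine ⟨Function.update α (k + 1) a, fun j hj => ?_⟩
    rcases Nat.lt_or_ge j (k + 1) with hj' | hj'
    · refine (le_of_eq (seqPotential_congr fun i hi => ?_)).trans (hα j (by omega))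
      rw [Function.update_of_ne (by omega)]
    · obtain rfl : j = k + 1 := by omega
      exact ha

/-- A single term of the potential is at most the whole sum, so `Fintype.card F ^ zeros ≤ (2 *
Z.card) ^ l`. As the field has at least `(2 * Z.card) ^ 2` elements, at most half of the symbols
vanish. -/
lemma exists_conv_zeroCount_le (Z : Finset F) (hZ : (2 * Z.card) ^ 2 ≤ Fintype.card F) (k : ℕ) :
    ∃ α : ℕ → F, ∀ l ≤ k, ∀ z : ℕ → F, (∀ i, z i ∈ Z) → z 0 ≠ 0 → 2 * zeroCount α z l ≤ l := by
  obtain ⟨α, hα⟩ := exists_seqPotential_le Z k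
  refine ⟨α, fun l hl z hz h0 => ?_⟩
  obtain rfl | ⟨j, rfl⟩ : l = 0 ∨ ∃ j, l = j + 1 := by
    cases l <;> simp
  · simp [zeroCount]
  obtain ⟨w, hw, hwz⟩ := exists_mem_seqs hz h0 j
  have h1 : Fintype.card F ^ zeroCount α w (j + 1) ≤ (2 * Z.card) ^ (j + 1) :=
    (Finset.single_le_sum (f := fun z => Fintype.card F ^ zeroCount α z (j + 1))
      (fun _ _ => Nat.zero_le _) hw).trans (hα j (by omega))
  rw [zeroCount_congr (fun _ _ => rfl) (fun i hi => hwz i (by omega))] at h1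
  have hpos : 1 < 2 * Z.card := by
    have : 0 < Z.card := Finset.card_pos.2 ⟨_, hz 0⟩
    omega
  have h2 : (2 * Z.card) ^ (2 * zeroCount α z (j + 1)) ≤ (2 * Z.card) ^ (j + 1) := by
    rw [pow_mul]
    exact (Nat.pow_le_pow_left hZ _).trans h1
  exact (Nat.pow_le_pow_iff_right hpos).1 h2

end TreeCode

/-- `code` is a tree code of depth `D`: it is causal, and two sequences that part at time `d`
have codewords that differ in at least half of the positions from `d` on. -/
structure IsTreeCode {A L : Type*} (D : ℕ) (code : (ℕ → A) → ℕ → L) : Prop where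
  causal : ∀ x y t, (∀ i ≤ t, x i = y i) → code x t = code y t
  dist : ∀ x y d l, d + l ≤ D → (∀ i < d, x i = y i) → x d ≠ y d →
    l ≤ 2 * Set.ncard {t | d ≤ t ∧ t < d + l ∧ code x t ≠ code y t}

theorem exists_isTreeCode (A : Type) [Finite A] :
    ∃ s : ℕ, ∀ D : ℕ, ∃ code : (ℕ → A) → ℕ → Fin s → Bool, IsTreeCode D code := by
  classical
  have := Fintype.ofFinite A
  -- The first summand lets `A` embed into `ZMod p`; the second makes the field large against the
  -- set `Z` of differences. Neither depends on the depth `D`.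
  obtain ⟨p, hp, hprime⟩ := Nat.exists_infinite_primes
    (Fintype.card A + (2 * (Fintype.card A * Fintype.card A)) ^ 2)
  have : Fact p.Prime := ⟨hprime⟩
  refine ⟨p, fun D => ?_⟩
  have hcard : Fintype.card A ≤ Fintype.card (ZMod p) := by
    rw [ZMod.card]; omega
  obtain ⟨φ⟩ := Function.Embedding.nonempty_of_card_le hcard
  let Z : Finset (ZMod p) := Finset.univ.image fun q : A × A => φ q.1 - φ q.2
  have hZ : (2 * Z.card) ^ 2 ≤ Fintype.card (ZMod p) := by
    have : Z.card ≤ Fintype.card A * Fintype.card A := by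
      refine Finset.card_image_le.trans ?_
      simp
    rw [ZMod.card]
    have := Nat.pow_le_pow_left (Nat.mul_le_mul_left 2 this) 2
    omega
  obtain ⟨α, hα⟩ := exists_conv_zeroCount_le Z hZ D
  -- Unary (one-hot) encoding of field elements; only injectivity matters.
  let ψ : ZMod p ↪ (Fin p → Bool) :=
    ⟨fun c i => decide ((ZMod.finEquiv p i) = c), fun c c' h => by
      have := congrFun h ((ZMod.finEquiv p).symm c)
      simpa using this⟩
  refine ⟨fun x t => ψ (conv α (fun i => φ (x i)) t), ?_, ?_⟩
  · intro x y t h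
    exact congrArg ψ (conv_congr (fun _ _ => rfl) fun i hi => congrArg φ (h i hi))
  · intro x y d l hl hpre hd
    have hz : ∀ i, φ (x (d + i)) - φ (y (d + i)) ∈ Z := fun i =>
      Finset.mem_image_of_mem (fun q : A × A => φ q.1 - φ q.2) (Finset.mem_univ (x (d + i), y (d + i)))
    have h0 : φ (x (d + 0)) - φ (y (d + 0)) ≠ 0 := by
      simpa [sub_eq_zero] using hd
    have h1 := hα l (by omega) (fun i => φ (x (d + i)) - φ (y (d + i))) hz h0
    have hconv : ∀ u, conv α (fun i => φ (x (d + i)) - φ (y (d + i))) u =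
        conv α (fun i => φ (x i)) (d + u) - conv α (fun i => φ (y i)) (d + u) := by
      intro u
      rw [← conv_sub, conv_shift (z := fun i => φ (x i) - φ (y i))
        (fun i hi => by simp [hpre i hi])]
    have hset : {t | d ≤ t ∧ t < d + l ∧ ψ (conv α (fun i => φ (x i)) t) ≠
        ψ (conv α (fun i => φ (y i)) t)} = ((Finset.range l).filter fun u =>
        ¬ conv α (fun i => φ (x (d + i)) - φ (y (d + i))) u = 0).image (d + ·) := by
      ext t
      simp only [Set.mem_ofPred_eq, Finset.coe_image, Finset.coe_filter, Finset.mem_range,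
        Set.mem_image, hconv, sub_eq_zero, ne_eq, ψ.injective.eq_iff]
      constructor
      · rintro ⟨ht, ht', hne⟩
        obtain ⟨u, rfl⟩ := Nat.exists_eq_add_of_le ht
        exact ⟨u, ⟨by omega, hne⟩, rfl⟩
      · rintro ⟨u, ⟨hu, hne⟩, rfl⟩
        exact ⟨by omega, by omega, hne⟩
    rw [hset, Set.ncard_coe_finset, Finset.card_image_of_injective _ (add_right_injective d)]
    have h2 := Finset.card_filter_add_card_filter_not (s := Finset.range l)
      (fun u => conv α (fun i => φ (x (d + i)) - φ (y (d + i))) u = 0)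
    rw [Finset.card_range] at h2
    have h3 : zeroCount α (fun i => φ (x (d + i)) - φ (y (d + i))) l = ((Finset.range l).filter
        fun u => conv α (fun i => φ (x (d + i)) - φ (y (d + i))) u = 0).card := by
      unfold zeroCount
      congr
    omega

/-! ### Nearest-codeword decoding of tree codes -/

section Decoding

variable {A : Type*} [Nonempty A] {s : ℕ}

/-- A sequence whose codeword is closest to the received word `w` in the first `t` positions. -/
noncomputable def decodeSeq (code : (ℕ → A) → ℕ → Fin s → Bool) (t : ℕ) (w : ℕ → Fin s → Bool) :
    ℕ → A :=
  Function.argmin fun z => ((Finset.range t).filter fun u => code z u ≠ w u).card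

lemma decodeSeq_congr {code : (ℕ → A) → ℕ → Fin s → Bool} {t : ℕ} {w w' : ℕ → Fin s → Bool}
    (h : ∀ u < t, w u = w' u) : decodeSeq code t w = decodeSeq code t w' := by
  unfold decodeSeq
  congr 1
  funext z
  congr 1
  refine Finset.filter_congr fun u hu => ?_
  rw [h u (Finset.mem_range.1 hu)]

lemma card_filter_range_split {p : ℕ → Prop} [DecidablePred p] {d t : ℕ} (h : d ≤ t) :
    ((Finset.range t).filter p).card =
      ((Finset.range d).filter p).card + ((Finset.Ico d t).filter p).card := by
  rw [← Finset.card_union_of_disjoint, ← Finset.filter_union, Finset.range_eq_Ico,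
    Finset.range_eq_Ico, Finset.Ico_union_Ico_eq_Ico (Nat.zero_le _) h]
  refine Finset.disjoint_filter_filter ?_
  rw [Finset.range_eq_Ico]
  exact Finset.Ico_disjoint_Ico_consecutive 0 d t

/-- Let `d` be the first error of the decoder. On `[d, t)` the two codewords differ in half of the
positions. The received word is no closer to the true codeword than to the decoded one, and they
agree before `d`, so a quarter of these positions are corrupted. -/
lemma IsTreeCode.decodeSeq_eq {D : ℕ} {code : (ℕ → A) → ℕ → Fin s → Bool}
    (hc : IsTreeCode D code) {t : ℕ} (ht : t ≤ D) {w : ℕ → Fin s → Bool} {z : ℕ → A}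
    {K : Finset ℕ} (hK : ∀ u < t, w u ≠ code z u → u ∈ K) :
    ∃ d ≤ t, (∀ u < d, decodeSeq code t w u = z u) ∧
      t - d ≤ 4 * ((Finset.Ico d t).filter (· ∈ K)).card := by
  classical
  by_cases hall : ∀ u < t, decodeSeq code t w u = z u
  · exact ⟨t, le_rfl, hall, by simp⟩
  push Not at hall
  set z' := decodeSeq code t w with hz'
  obtain ⟨hdt, hne⟩ := Nat.find_spec hall
  set d := Nat.find hall with hd
  have hpre : ∀ u < d, z' u = z u := by
    intro u hu
    by_contra h
    exact Nat.find_min hall hu ⟨hu.trans hdt, h⟩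
  refine ⟨d, hdt.le, hpre, ?_⟩
  have hmin : ((Finset.range t).filter fun u => code z' u ≠ w u).card ≤
      ((Finset.range t).filter fun u => code z u ≠ w u).card :=
    Function.argmin_le (fun z => ((Finset.range t).filter fun u => code z u ≠ w u).card) z
  rw [card_filter_range_split hdt.le, card_filter_range_split hdt.le] at hmin
  have hlow : (Finset.range d).filter (fun u => code z' u ≠ w u) =
      (Finset.range d).filter (fun u => code z u ≠ w u) := by
    refine Finset.filter_congr fun u hu => ?_
    rw [hc.causal z' z u fun i hi => hpre i (by have := Finset.mem_range.1 hu; omega)]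
  rw [hlow] at hmin
  have hdist := hc.dist z z' d (t - d) (by omega) (fun i hi => (hpre i hi).symm) hne.symm
  have hset : {u | d ≤ u ∧ u < d + (t - d) ∧ code z u ≠ code z' u} =
      ((Finset.Ico d t).filter fun u => code z u ≠ code z' u : Finset ℕ) := by
    ext u
    simp only [Set.mem_ofPred_eq, Finset.coe_filter, Finset.mem_Ico, and_assoc,
      Nat.add_sub_cancel' hdt.le]
  rw [hset, Set.ncard_coe_finset] at hdist
  have hunion : ((Finset.Ico d t).filter fun u => code z u ≠ code z' u).card ≤
      ((Finset.Ico d t).filter fun u => code z' u ≠ w u).card +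
        ((Finset.Ico d t).filter fun u => code z u ≠ w u).card := by
    refine (Finset.card_le_card fun u hu => ?_).trans (Finset.card_union_le _ _)
    simp only [Finset.mem_filter, Finset.mem_union] at hu ⊢
    by_contra h
    push Not at h
    exact hu.2 ((h.2 hu.1).trans (h.1 hu.1).symm)
  have hsub : ((Finset.Ico d t).filter fun u => code z u ≠ w u).card ≤
      ((Finset.Ico d t).filter (· ∈ K)).card := by
    refine Finset.card_le_card fun u hu => ?_
    simp only [Finset.mem_filter, Finset.mem_Ico] at hu ⊢
    exact ⟨hu.1, hK u hu.1.2 (Ne.symm hu.2)⟩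
  omega

end Decoding

/-! ### Simulation with backing up, on a stack of rounds -/

section Stack

variable {n R : ℕ} {X : Fin n → Type u} (P : Protocol X R) (x : ∀ i, X i)

/-- The bits broadcast in some execution of a protocol, the last round first. -/
abbrev Stack (n : ℕ) : Type := List (Fin n → Bool)

/-- The bit broadcast by `j` in round `s`. -/
def stackBit (st : Stack n) (s : ℕ) (j : Fin n) : Bool := st.reverse.getD s (fun _ => false) j

/-- What party `i` has to broadcast after `st`. -/
def nextBit (i : Fin n) (a : X i) (st : Stack n) : Bool :=
  -- Past round `R` the protocol continues with dummy bits, so that a correct stack can keep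
  -- growing.
  if h : st.length < R then P.bit i a ⟨st.length, h⟩ fun s j => stackBit st s j else false

/-- The bits of party `i` in a stack are those that the protocol prescribes. -/
def Consistent (i : Fin n) (a : X i) : Stack n → Prop
  | [] => True
  | v :: st => Consistent i a st ∧ v i = nextBit P i a st

open scoped Classical in
/-- The next symbol of party `i`: its next bit, or `none` as a demand to back up. -/
noncomputable def move (i : Fin n) (a : X i) (st : Stack n) : Option Bool :=
  if Consistent P i a st then some (nextBit P i a st) else none

open scoped Classical in
/-- The effect of the symbols broadcast at one time. -/
noncomputable def stepStack (v : Fin n → Option Bool) (st : Stack n) : Stack n :=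
  -- One demand suffices to pop, since a wrong bit is detected only by the party that owns it. The
  -- default `false` is never reached.
  if ∃ j, v j = none then st.tail else (fun j => (v j).getD false) :: st

/-- The stack that results from the symbols broadcast at times less than `t`. -/
noncomputable def stackAt (z : ℕ → Fin n → Option Bool) : ℕ → Stack n
  | 0 => []
  | t + 1 => stepStack (z t) (stackAt z t)

lemma stackAt_congr {z z' : ℕ → Fin n → Option Bool} {t : ℕ} (h : ∀ u < t, z u = z' u) :
    stackAt z t = stackAt z' t := by
  induction t with
  | zero => rfl
  | succ t ih => rw [stackAt, stackAt, h t t.lt_succ_self, ih fun u hu => h u (by omega)]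

/-- The stack is an initial part of the noiseless execution. -/
def Correct (st : Stack n) : Prop := ∀ i, Consistent P i (x i) st

lemma correct_cons {v : Fin n → Bool} {st : Stack n} :
    Correct P x (v :: st) ↔ Correct P x st ∧ ∀ i, v i = nextBit P i (x i) st :=
  forall_and

open scoped Classical in
/-- The number of correct entries of a stack minus the number of incorrect ones. -/
noncomputable def progress : Stack n → ℤ
  | [] => 0
  | v :: st => if Correct P x (v :: st) then progress st + 1 else progress st - 1

lemma progress_le_length (st : Stack n) : progress P x st ≤ st.length := by
  induction st with
  | nil => simp [progress]
  | cons v st ih =>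
    rw [progress, List.length_cons]
    split_ifs <;> push_cast <;> omega

lemma progress_step_ge (v : Fin n → Option Bool) (st : Stack n) :
    progress P x st - 1 ≤ progress P x (stepStack v st) := by
  unfold stepStack
  split_ifs
  · cases st with
    | nil => simp [progress]
    | cons w st =>
      rw [progress, List.tail_cons]
      split_ifs <;> omega
  · rw [progress]
    split_ifs <;> omega

lemma progress_stackAt_ge (z : ℕ → Fin n → Option Bool) (d l : ℕ) :
    progress P x (stackAt z d) - l ≤ progress P x (stackAt z (d + l)) := by
  induction l with
  | zero => simp
  | succ l ih =>
    have := progress_step_ge P x (z (d + l)) (stackAt z (d + l))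
    rw [← Nat.add_assoc, stackAt]
    push_cast
    omega

/-- A correct stack gains a correct entry. In an incorrect one some party finds a wrong bit of its
own, and the popped top entry is incorrect, because correctness passes to tails. -/
lemma progress_step_move {v : Fin n → Option Bool} {st : Stack n}
    (hv : ∀ i, v i = move P i (x i) st) :
    progress P x st + 1 ≤ progress P x (stepStack v st) := by
  by_cases h : Correct P x st
  · have hv' : ∀ i, v i = some (nextBit P i (x i) st) := fun i => by rw [hv, move, if_pos (h i)]
    rw [stepStack, if_neg (by simp [hv']), progress, if_pos]
    exact (correct_cons P x).2 ⟨h, fun i => by simp [hv']⟩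
  · have hex : ∃ j, v j = none := by
      unfold Correct at h
      push Not at h
      obtain ⟨j, hj⟩ := h
      exact ⟨j, by rw [hv, move, if_neg hj]⟩
    rw [stepStack, if_pos hex]
    cases st with
    | nil => exact absurd (fun _ => trivial) h
    | cons w st =>
      rw [progress, if_neg h, List.tail_cons]
      omega

/-- Incorrect entries all lie above the correct ones, so removing them leaves a correct stack and
can only increase the progress. -/
lemma exists_correct_suffix (st : Stack n) :
    ∃ st', st' <:+ st ∧ Correct P x st' ∧ progress P x st ≤ st'.length := by
  induction st with
  | nil => exact ⟨[], List.suffix_rfl, fun _ => trivial, by simp [progress]⟩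
  | cons v st ih =>
    by_cases h : Correct P x (v :: st)
    · exact ⟨_, List.suffix_rfl, h, progress_le_length P x _⟩
    · obtain ⟨st', h1, h2, h3⟩ := ih
      refine ⟨st', h1.trans (List.suffix_cons _ _), h2, ?_⟩
      rw [progress, if_neg h]
      omega

lemma stackBit_of_suffix {st st' : Stack n} (h : st' <:+ st) {s : ℕ} (hs : s < st'.length)
    (j : Fin n) : stackBit st s j = stackBit st' s j := by
  obtain ⟨l, rfl⟩ := h
  unfold stackBit
  rw [List.reverse_append, List.getD_append _ _ _ _ (by simpa using hs)]

lemma stackBit_cons_length (v : Fin n → Bool) (st : Stack n) (j : Fin n) :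
    stackBit (v :: st) st.length j = v j := by
  simp [stackBit]

lemma Correct.stackBit_eq {st : Stack n} (h : Correct P x st) (r : Fin R) (hr : r < st.length)
    (j : Fin n) : stackBit st r j = P.sent x (fun _ => false) r j := by
  induction st generalizing r j with
  | nil => simp at hr
  | cons v st ih =>
    obtain ⟨h1, h2⟩ := (correct_cons P x).1 h
    rcases Nat.lt_or_ge r st.length with hlt | hge
    · rw [stackBit_of_suffix (List.suffix_cons _ _) hlt, ih h1 r hlt]
    · rw [List.length_cons] at hr
      have hrl : (r : ℕ) = st.length := by omega
      have hlen : st.length < R := hrl ▸ r.2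
      obtain rfl : r = ⟨st.length, hlen⟩ := Fin.ext hrl
      rw [stackBit_cons_length, h2, nextBit, dif_pos hlen, Protocol.sent]
      congr 1
      funext s j
      rw [Bool.xor_false]
      exact ih h1 ⟨s, s.2.trans hlen⟩ s.2 j

end Stack

/-! ### Charging lost progress to corrupted times -/

section Progress

variable {n R : ℕ} {X : Fin n → Type u} (P : Protocol X R) (x : ∀ i, X i)
  {N : ℕ} {Z : ℕ → Fin n → Option Bool} {H : Fin n → ℕ → ℕ → Fin n → Option Bool} {K : Finset ℕ}

/-- The histories `H i t` that the parties decode are right but for a final part, and at most a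
constant times as long as the number of corruptions, at times in `K`, in that part. -/
def NearlyDecoded (N : ℕ) (Z : ℕ → Fin n → Option Bool) (H : Fin n → ℕ → ℕ → Fin n → Option Bool)
    (K : Finset ℕ) : Prop :=
  ∀ i, ∀ t ≤ N, ∃ d ≤ t, (∀ u < d, H i t u = Z u) ∧
    t - d ≤ 4 * ((Finset.Ico d t).filter (· ∈ K)).card

lemma progress_stackAt_lower (hH : NearlyDecoded N Z H K)
    (hZ : ∀ t < N, ∀ i, Z t i = move P i (x i) (stackAt (H i t) t)) {t : ℕ} (ht : t ≤ N) :
    (t : ℤ) ≤ progress P x (stackAt Z t) + 16 * ((Finset.range t).filter (· ∈ K)).card := by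
  induction t using Nat.strong_induction_on with
  | _ t ih =>
    cases t with
    | zero => simp [stackAt, progress]
    | succ t =>
      -- In the bad case the loss since `d`, against a gain of one per step, is at most `2 * (t + 1
      -- - d) ≤ 4 * (t - d)`, hence at most `16` times the number of corruptions since `d`.
      -- Otherwise every party decodes the history at time `t` without error.
      by_cases hbad : ∃ d < t, t - d ≤ 4 * ((Finset.Ico d t).filter (· ∈ K)).card
      · obtain ⟨d, hd, hdt⟩ := hbad
        have h1 := ih d (by omega) (by omega)
        have h2 := progress_stackAt_ge P x Z d (t + 1 - d)
        rw [Nat.add_sub_cancel' (by omega)] at h2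
        have h3 := card_filter_range_split (p := (· ∈ K)) (show d ≤ t + 1 by omega)
        have h4 : ((Finset.Ico d t).filter (· ∈ K)).card ≤
            ((Finset.Ico d (t + 1)).filter (· ∈ K)).card :=
          Finset.card_le_card (Finset.filter_subset_filter _
            (Finset.Ico_subset_Ico le_rfl t.le_succ))
        omega
      · push Not at hbad
        have hgood : ∀ i, stackAt (H i t) t = stackAt Z t := by
          intro i
          obtain ⟨d, hd, hu, hle⟩ := hH i t (by omega)
          obtain rfl : d = t := by
            by_contra hne
            have := hbad d (by omega)
            omega
          exact stackAt_congr hu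
        have h1 := ih t (by omega) (by omega)
        have h2 := progress_step_move P x (v := Z t) (st := stackAt Z t) fun i => by
          rw [hZ t (by omega), hgood]
        have h3 := card_filter_range_split (p := (· ∈ K)) t.le_succ
        rw [stackAt]
        simp only [Nat.succ_eq_add_one] at h3
        omega

/-- The final stack of party `i` follows the true one up to `d` and then loses at most `2 * R - d`.
Its progress is therefore at least `2 * R - 16 * K.card ≥ R`, which leaves a correct suffix covering
all `R` rounds. -/
lemma stackBit_eq_sent (hH : NearlyDecoded (2 * R) Z H K)
    (hZ : ∀ t < 2 * R, ∀ i, Z t i = move P i (x i) (stackAt (H i t) t))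
    (hK : 16 * K.card ≤ R) (i j : Fin n) (r : Fin R) :
    stackBit (stackAt (H i (2 * R)) (2 * R)) r j = P.sent x (fun _ => false) r j := by
  obtain ⟨d, hd, hu, hle⟩ := hH i (2 * R) le_rfl
  have h1 := progress_stackAt_lower P x hH hZ hd
  have h2 := progress_stackAt_ge P x (H i (2 * R)) d (2 * R - d)
  rw [Nat.add_sub_cancel' hd, stackAt_congr hu] at h2
  have h3 := card_filter_range_split (p := (· ∈ K)) hd
  have h4 : ((Finset.range (2 * R)).filter (· ∈ K)).card ≤ K.card :=
    Finset.card_le_card fun u hu => (Finset.mem_filter.1 hu).2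
  obtain ⟨st, hst, hcor, hlen⟩ := exists_correct_suffix P x (stackAt (H i (2 * R)) (2 * R))
  have hr : (r : ℕ) < st.length := by have := r.2; omega
  rw [stackBit_of_suffix hst hr, hcor.stackBit_eq P x r hr]

end Progress

/-! ### The outer simulation, robust against noise in few rounds -/

section RobustSimulation

variable {n R s : ℕ} {X : Fin n → Type u} (P : Protocol X R)
  (code : (ℕ → Option Bool) → ℕ → Fin s → Bool)

open scoped Classical in
/-- The history of party `i` at time `t`: its own symbols, and those that it decodes from the
received labels `w`. -/
noncomputable def history (i : Fin n) (w : ℕ → {j : Fin n // j ≠ i} → Fin s → Bool)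
    (own : ℕ → Option Bool) (t : ℕ) : ℕ → Fin n → Option Bool := fun u j =>
  if h : j = i then own u else decodeSeq code t (fun v => w v ⟨j, h⟩) u

/-- The symbols of party `i` at times less than `t`. -/
noncomputable def ownSeq (i : Fin n) (a : X i) (w : ℕ → {j : Fin n // j ≠ i} → Fin s → Bool) :
    ℕ → ℕ → Option Bool
  | 0 => fun _ => none
  | t + 1 => Function.update (ownSeq i a w t) t
      (move P i a (stackAt (history code i w (ownSeq i a w t) t) t))

variable {P code}

lemma history_congr {i : Fin n} {w w' : ℕ → {j : Fin n // j ≠ i} → Fin s → Bool}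
    {own : ℕ → Option Bool} {t : ℕ} (h : ∀ v < t, w v = w' v) :
    history code i w own t = history code i w' own t := by
  funext u j
  unfold history
  split_ifs with hj
  · rfl
  · rw [decodeSeq_congr fun v hv => by rw [h v hv]]

lemma ownSeq_congr {i : Fin n} {a : X i} {w w' : ℕ → {j : Fin n // j ≠ i} → Fin s → Bool}
    {t : ℕ} (h : ∀ v < t, w v = w' v) :
    ownSeq P code i a w (t + 1) = ownSeq P code i a w' (t + 1) := by
  induction t with
  | zero => rw [ownSeq, ownSeq, ownSeq, ownSeq, history_congr h]
  | succ t ih => rw [ownSeq, ih fun v hv => h v (by omega), history_congr h, ← ownSeq]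

lemma ownSeq_eq {i : Fin n} {a : X i} {w : ℕ → {j : Fin n // j ≠ i} → Fin s → Bool}
    {t u : ℕ} (h : u < t) : ownSeq P code i a w t u = ownSeq P code i a w (u + 1) u := by
  induction t with
  | zero => omega
  | succ t ih =>
    rcases Nat.lt_or_ge u t with hut | hut
    · rw [ownSeq, Function.update_of_ne hut.ne, ih hut]
    · obtain rfl : u = t := by omega
      rfl

/-- The labels in a received transcript, of `s` bits each. -/
def recvLabels {i : Fin n} {r : ℕ} (m : Transcript n i r) :
    ℕ → {j : Fin n // j ≠ i} → Fin s → Bool := fun t j k =>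
  if h : k + s * t < r then m ⟨k + s * t, h⟩ j else false

variable (P code)

/-- The simulation of `P` in which the symbols of all parties are sent by a tree code, bit by
bit. -/
noncomputable def robustSim : Simulation X R (2 * R * s) where
  bit i a r m := code (ownSeq P code i a (recvLabels m) (r / s + 1)) (r / s)
    ⟨r % s, Nat.mod_lt _ (Nat.pos_of_ne_zero fun h => by
      exact Nat.not_lt_zero _ (r.2.trans_eq (by rw [h, Nat.mul_zero])))⟩
  output i a m :=
    let st := stackAt
      (history code i (recvLabels m) (ownSeq P code i a (recvLabels m) (2 * R)) (2 * R)) (2 * R)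
    (fun r => stackBit st r i, fun r j => stackBit st r j)

variable (x : ∀ i, X i) (e : Noise n (2 * R * s))

/-- The labels that party `i` receives. -/
noncomputable def simLabels (i : Fin n) : ℕ → {j : Fin n // j ≠ i} → Fin s → Bool :=
  recvLabels ((robustSim P code).received x e i)

/-- The symbol of party `i` at time `t`. -/
noncomputable def simSymbol (t : ℕ) (i : Fin n) : Option Bool :=
  ownSeq P code i (x i) (simLabels P code x e i) (t + 1) t

/-- The history of party `i` at time `t`. -/
noncomputable def simHistory (i : Fin n) (t : ℕ) : ℕ → Fin n → Option Bool :=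
  history code i (simLabels P code x e i) (ownSeq P code i (x i) (simLabels P code x e i) t) t

/-- The times at which some bit is flipped. -/
noncomputable def noisyTimes : Finset ℕ :=
  (Finset.univ.filter fun r => ∃ l, e (r, l) = true).image fun r : Fin (2 * R * s) => (r : ℕ) / s

lemma blockIndex_lt {s k t N : ℕ} (ht : t < N) (hk : k < s) : k + s * t < N * s :=
  calc k + s * t < s + s * t := by omega
    _ = (t + 1) * s := by ring
    _ ≤ N * s := Nat.mul_le_mul_right _ ht

variable {code}

lemma simSymbol_eq_move (t : ℕ) (i : Fin n) :
    simSymbol P code x e t i = move P i (x i) (stackAt (simHistory P code x e i t) t) := by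
  rw [simSymbol, ownSeq, Function.update_self]
  rfl

/-- The symbol of time `t` uses only labels of earlier times, which are complete by round `k + s *
t`. So the padding in `recvLabels` is harmless, and the symbol agrees with the one computed from the
full transcript. -/
lemma sent_robustSim (hcode : IsTreeCode (2 * R) code) {t : ℕ} (ht : t < 2 * R) (k : Fin s)
    (i : Fin n) :
    (robustSim P code).sent x e ⟨k + s * t, blockIndex_lt ht k.2⟩ i =
      code (fun u => simSymbol P code x e u i) t k := by
  obtain ⟨k, hk⟩ := k
  have hs : 0 < s := by omega
  have hdiv : (k + s * t) / s = t := by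
    rw [Nat.add_mul_div_left _ _ hs, Nat.div_eq_of_lt hk, zero_add]
  have hmod : (k + s * t) % s = k := by
    rw [Nat.add_mul_mod_self_left, Nat.mod_eq_of_lt hk]
  rw [Protocol.sent]
  simp only [robustSim, hdiv, hmod]
  refine congrFun (hcode.causal _ _ t fun u hu => ?_) _
  rw [ownSeq_congr (w' := simLabels P code x e i) fun v hv => ?_, ownSeq_eq (by omega)]
  · rfl
  · funext j k'
    have h1 : k' + s * v < k + s * t :=
      calc k' + s * v < t * s := blockIndex_lt hv k'.2
        _ ≤ k + s * t := by rw [Nat.mul_comm]; omega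
    have h2 : k' + s * v < 2 * R * s := h1.trans (blockIndex_lt ht hk)
    rw [simLabels, recvLabels, recvLabels, dif_pos h1, dif_pos h2]
    rfl

lemma simLabels_eq (hcode : IsTreeCode (2 * R) code) {t : ℕ} (ht : t < 2 * R) (i : Fin n)
    (j : {j : Fin n // j ≠ i}) (hK : t ∉ noisyTimes e) :
    simLabels P code x e i t j = code (fun u => simSymbol P code x e u j) t := by
  funext k
  have h2 := blockIndex_lt ht k.2
  have hs : 0 < s := by have := k.2; omega
  rw [simLabels, recvLabels, dif_pos h2, Protocol.received, sent_robustSim P x e hcode ht]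
  have : e (⟨k + s * t, h2⟩, ⟨(j, i), j.2⟩) = false := by
    by_contra h
    refine hK (Finset.mem_image.2 ⟨⟨k + s * t, h2⟩, Finset.mem_filter.2 ⟨Finset.mem_univ _,
      ⟨(j, i), j.2⟩, eq_true_of_ne_false h⟩, ?_⟩)
    · simp only
      rw [Nat.add_mul_div_left _ _ hs, Nat.div_eq_of_lt k.2, zero_add]
  rw [this, Bool.xor_false]

lemma simHistory_apply_self (i : Fin n) {t u : ℕ} (h : u < t) :
    simHistory P code x e i t u i = simSymbol P code x e u i := by
  rw [simHistory, history, dif_pos rfl, ownSeq_eq h]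
  rfl

lemma nearlyDecoded_simHistory (hcode : IsTreeCode (2 * R) code) :
    NearlyDecoded (2 * R) (simSymbol P code x e) (simHistory P code x e) (noisyTimes e) := by
  intro i t ht
  have key : ∀ j, ∃ d ≤ t, (∀ u < d, simHistory P code x e i t u j = simSymbol P code x e u j) ∧
      t - d ≤ 4 * ((Finset.Ico d t).filter (· ∈ noisyTimes e)).card := by
    intro j
    by_cases hj : j = i
    · subst hj
      exact ⟨t, le_rfl, fun u hu => simHistory_apply_self P x e j hu, by simp⟩
    · obtain ⟨d, hd, h1, h2⟩ := hcode.decodeSeq_eq ht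
        (w := fun v => simLabels P code x e i v ⟨j, hj⟩)
        (z := fun u => simSymbol P code x e u j) (K := noisyTimes e) fun u hu hne => by
          by_contra hK
          exact hne (simLabels_eq P x e hcode (hu.trans_le ht) i ⟨j, hj⟩ hK)
      refine ⟨d, hd, fun u hu => ?_, h2⟩
      rw [simHistory, history, dif_neg hj, h1 u hu]
  choose d hd h1 h2 using key
  -- The sender with the earliest possible error determines `d` for the joint history.
  obtain ⟨j, -, hj⟩ := Finset.exists_min_image Finset.univ d ⟨i, Finset.mem_univ i⟩
  refine ⟨d j, hd j, fun u hu => funext fun j' => ?_, h2 j⟩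
  exact h1 j' u (hu.trans_le (hj j' (Finset.mem_univ _)))

theorem robustSim_succeeds (hcode : IsTreeCode (2 * R) code)
    (he : 16 * (Finset.univ.filter fun r : Fin (2 * R * s) => ∃ l, e (r, l) = true).card ≤ R) :
    (robustSim P code).Succeeds P x e := by
  have hK : 16 * (noisyTimes e).card ≤ R :=
    (Nat.mul_le_mul_left _ Finset.card_image_le).trans he
  have key := stackBit_eq_sent P x (nearlyDecoded_simHistory P x e hcode)
    (fun t _ i => simSymbol_eq_move P x e t i) hK
  intro i
  refine Prod.ext (funext fun r => key i i r) (funext fun r => funext fun j => ?_)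
  exact (key i j r).trans (Bool.xor_false _).symm

end RobustSimulation

/-! ### Independence and tail bounds for the noise -/

section Probability

variable {κ κ' ι : Type*} [Fintype κ] [Fintype κ'] (ν : Measure Bool) [IsProbabilityMeasure ν]

lemma map_comp_pi (f : κ' → κ) (hf : f.Injective) :
    (Measure.pi fun _ : κ => ν).map (fun e a => e (f a)) = Measure.pi fun _ : κ' => ν := by
  have h : iIndepFun (fun (i : κ) (e : κ → Bool) => e i) (Measure.pi fun _ : κ => ν) :=
    iIndepFun_pi (X := fun _ => id) fun _ => aemeasurable_id
  have h' := (h.precomp hf).map_fun_eq_pi_map fun i => (measurable_pi_apply _).aemeasurable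
  rw [h']
  congr 1
  funext a
  exact (measurePreserving_eval (fun _ : κ => ν) (f a)).map_eq

lemma pi_real_comp (f : κ' → κ) (hf : f.Injective) (E : Set (κ' → Bool)) :
    (Measure.pi fun _ : κ => ν).real {e | (fun a => e (f a)) ∈ E} =
      (Measure.pi fun _ : κ' => ν).real E := by
  rw [← map_comp_pi ν f hf, map_measureReal_apply (by fun_prop) E.toFinite.measurableSet]
  rfl

lemma pi_real_inter {E E' : Set (κ → Bool)} {S S' : Set κ} (hE : DependsOn (· ∈ E) S)
    (hE' : DependsOn (· ∈ E') S') (h : Disjoint S S') :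
    (Measure.pi fun _ : κ => ν).real (E ∩ E') =
      (Measure.pi fun _ : κ => ν).real E * (Measure.pi fun _ : κ => ν).real E' := by
  classical
  have hi : iIndepFun (fun (i : κ) (e : κ → Bool) => e i) (Measure.pi fun _ : κ => ν) :=
    iIndepFun_pi (X := fun _ => id) fun _ => aemeasurable_id
  have h2 := hi.indepFun_finset S.toFinset S'.toFinset (by simpa using h) fun i =>
    measurable_pi_apply i
  have key : ∀ {E : Set (κ → Bool)} {S : Set κ}, DependsOn (· ∈ E) S →
      ∃ B : Set (S.toFinset → Bool), E = (fun (e : κ → Bool) (i : S.toFinset) => e i) ⁻¹' B := by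
    intro E S hE
    refine ⟨(fun (e : κ → Bool) (i : S.toFinset) => e i) '' E, ?_⟩
    refine Set.Subset.antisymm (Set.subset_preimage_image _ _) ?_
    rintro e ⟨e', he', heq⟩
    have := hE (x := e) (y := e') fun i hi => (congrFun heq ⟨i, by simpa using hi⟩).symm
    exact this.mpr he'
  obtain ⟨B, hB⟩ := key hE
  obtain ⟨B', hB'⟩ := key hE'
  have := h2.measure_inter_preimage_eq_mul B B' B.toFinite.measurableSet B'.toFinite.measurableSet
  rw [← hB, ← hB'] at this
  simp only [measureReal_def, this, ENNReal.toReal_mul]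

lemma pi_real_biInter_le {E : ι → Set (κ → Bool)} {S : ι → Set κ} {q : ℝ} (A : Finset ι)
    (hE : ∀ i ∈ A, DependsOn (· ∈ E i) (S i)) (hS : (A : Set ι).PairwiseDisjoint S)
    (hq : ∀ i ∈ A, (Measure.pi fun _ : κ => ν).real (E i) ≤ q) :
    (Measure.pi fun _ : κ => ν).real {e | ∀ i ∈ A, e ∈ E i} ≤ q ^ A.card := by
  classical
  induction A using Finset.induction_on with
  | empty => simp
  | insert a A ha ih =>
    have hset : {e | ∀ i ∈ insert a A, e ∈ E i} = E a ∩ {e | ∀ i ∈ A, e ∈ E i} := by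
      ext e; simp
    have hdep : DependsOn (· ∈ {e | ∀ i ∈ A, e ∈ E i}) (⋃ i ∈ A, S i) := by
      intro x y hxy
      refine propext (forall₂_congr fun i hi => ?_)
      exact iff_of_eq (hE i (Finset.mem_insert_of_mem hi) fun j hj =>
        hxy j (Set.mem_biUnion hi hj))
    have hdisj : Disjoint (S a) (⋃ i ∈ A, S i) := by
      refine Set.disjoint_iUnion₂_right.2 fun i hi => ?_
      exact hS (by simp) (by simp [hi]) (fun h => ha (h ▸ hi))
    rw [hset, pi_real_inter ν (hE a (by simp)) hdep hdisj, Finset.card_insert_of_notMem ha, pow_succ']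
    have h1 := hq a (by simp)
    refine mul_le_mul h1 (ih (fun i hi => hE i (by simp [hi])) ?_ fun i hi => hq i (by simp [hi]))
      measureReal_nonneg (measureReal_nonneg.trans h1)
    exact hS.subset (by simp)

-- Union bound over the `k`-subsets of `s`, of which there are at most `2 ^ s.card`; events on
-- disjoint coordinates are independent.
open scoped Classical in
lemma pi_real_card_ge_le {E : ι → Set (κ → Bool)} {S : ι → Set κ} {q : ℝ} (s : Finset ι) (k : ℕ)
    (hE : ∀ i ∈ s, DependsOn (· ∈ E i) (S i)) (hS : (s : Set ι).PairwiseDisjoint S)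
    (hq : ∀ i ∈ s, (Measure.pi fun _ : κ => ν).real (E i) ≤ q) (hq0 : 0 ≤ q) :
    (Measure.pi fun _ : κ => ν).real {e | k ≤ (s.filter fun i => e ∈ E i).card} ≤
      2 ^ s.card * q ^ k := by
  have hsub : {e | k ≤ (s.filter fun i => e ∈ E i).card} ⊆
      ⋃ A ∈ s.powersetCard k, {e | ∀ i ∈ A, e ∈ E i} := by
    intro e he
    obtain ⟨A, hA, hc⟩ := Finset.exists_subset_card_eq (show k ≤ _ from he)
    refine Set.mem_biUnion (x := A) ?_ fun i hi => (Finset.mem_filter.1 (hA hi)).2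
    exact Finset.mem_powersetCard.2 ⟨hA.trans (Finset.filter_subset _ _), hc⟩
  refine (measureReal_mono hsub (measure_ne_top _ _)).trans ?_
  refine (measureReal_biUnion_finset_le _ _).trans ?_
  have hb : ∀ A ∈ s.powersetCard k,
      (Measure.pi fun _ : κ => ν).real {e | ∀ i ∈ A, e ∈ E i} ≤ q ^ k := by
    intro A hA
    obtain ⟨hA', rfl⟩ := Finset.mem_powersetCard.1 hA
    exact pi_real_biInter_le ν A (fun i hi => hE i (hA' hi)) (hS.subset (by simpa using hA'))
      fun i hi => hq i (hA' hi)
  refine (Finset.sum_le_card_nsmul _ _ _ hb).trans ?_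
  rw [nsmul_eq_mul, Finset.card_powersetCard]
  gcongr
  exact_mod_cast Nat.choose_le_two_pow _ _

/-- The exponential decay rate of the probability that a repeated bit is received wrongly. -/
noncomputable def decayRate (ε : unitInterval) : ℝ := 1 - (1 - 2 * (ε : ℝ)) ^ 2 / 2

lemma decayRate_lt_one {ε : unitInterval} (hε : (ε : ℝ) < 1 / 2) : decayRate ε < 1 := by
  unfold decayRate
  have : 0 < (1 - 2 * (ε : ℝ)) ^ 2 := by
    apply pow_pos; linarith
  linarith

lemma decayRate_pos {ε : unitInterval} (hε : (ε : ℝ) < 1 / 2) : 0 < decayRate ε := by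
  unfold decayRate
  have := ε.2.1
  nlinarith

/-- The bits `e` are flipped in at least half of the positions. -/
def MajorityFlipped {ρ : ℕ} (e : Fin ρ → Bool) : Prop :=
  ρ ≤ 2 * (Finset.univ.filter fun a => e a = true).card

/-- Exponential moment bound: flipped bits get weight `t > 1`, the others `t⁻¹`, so the product is
at least `1` on the event. -/
lemma pi_real_majorityFlipped_le {ε : unitInterval} (hε : (ε : ℝ) < 1 / 2) {ρ : ℕ}
    (c : Fin ρ → κ) (hc : c.Injective) :
    (Measure.pi fun _ : κ => bernoulliMeasure true false ε).real
      {e | MajorityFlipped fun a => e (c a)} ≤ decayRate ε ^ ρ := by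
  refine (pi_real_comp _ c hc {e | MajorityFlipped e}).trans_le ?_
  -- With this `t` the mean weight `ε * t + (1 - ε) / t` is `2 * ε * (1 - ε) + 1 / 2 = decayRate ε`.
  -- The optimal weight would be undefined at `ε = 0`.
  set t : ℝ := 2 - 2 * ε with ht
  have ht1 : 1 < t := by linarith
  let w : Bool → ℝ := fun b => if b then t else t⁻¹
  have hw : ∀ b, 0 < w b := by
    intro b
    cases b <;> simp [w] <;> linarith
  have hprod : ∀ e : Fin ρ → Bool, MajorityFlipped e → 1 ≤ ∏ a, w (e a) := by
    intro e he
    unfold MajorityFlipped at he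
    have hcard := Finset.card_filter_add_card_filter_not (s := (Finset.univ : Finset (Fin ρ)))
      (fun a => e a = true)
    rw [Finset.card_univ, Fintype.card_fin] at hcard
    simp only [w]
    rw [Finset.prod_ite, Finset.prod_const, Finset.prod_const, inv_pow, ← div_eq_mul_inv,
      one_le_div (by positivity)]
    exact pow_le_pow_right₀ ht1.le (by omega)
  have hint : ∫ e, ∏ a, w (e a) ∂(Measure.pi fun _ : Fin ρ => bernoulliMeasure true false ε) =
      decayRate ε ^ ρ := by
    rw [integral_fintype_prod_eq_prod (f := fun _ => w), Finset.prod_const, Finset.card_univ,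
      Fintype.card_fin, integral_bernoulliMeasure]
    congr 1
    have : t ≠ 0 := by linarith
    have h1 : (1 : ℝ) - ε ≠ 0 := by linarith
    simp only [w, decayRate, smul_eq_mul, ht] at this ⊢
    simp
    field_simp
    ring
  rw [← hint, ← integral_indicator_one (Set.toFinite _).measurableSet]
  refine integral_mono .of_finite .of_finite fun e => ?_
  by_cases he : MajorityFlipped e
  · simpa [Set.indicator, he] using hprod e he
  · simpa [Set.indicator, he] using Finset.prod_nonneg fun a _ => (hw (e a)).le

end Probability

/-! ### Replacing each round by a run of a gadget -/

section Composition

/-- A `G`-round protocol by which the parties broadcast one bit each, where `dec` is how the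
received transcript is decoded. -/
structure Gadget (n G : ℕ) where
  bit : (i : Fin n) → Bool → (r : Fin G) → Transcript n i r → Bool
  dec : (i : Fin n) → Transcript n i G → {j : Fin n // j ≠ i} → Bool

namespace Gadget

variable {n G M R : ℕ} {X : Fin n → Type u}

/-- The gadget as a protocol whose inputs are the bits to be broadcast. -/
def toProtocol (Q : Gadget n G) : Protocol (fun _ : Fin n => Bool) G := ⟨Q.bit⟩

/-- On noise `e`, all bits are decoded correctly by all parties. -/
def Reliable (Q : Gadget n G) (e : Noise n G) : Prop :=
  ∀ b : Fin n → Bool, ∀ i j, Q.dec i (Q.toProtocol.received b e i) j = b j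

/-- The noise in the `r`-th block of `G` rounds. -/
def block (e : Noise n (M * G)) (r : Fin M) : Noise n G :=
  fun c => e (finProdFinEquiv (r, c.1), c.2)

/-- The bits decoded from the complete blocks of a transcript. -/
def decodeBlocks (Q : Gadget n G) (i : Fin n) {r : ℕ} (m : Transcript n i r) (t : ℕ)
    (ht : t * G ≤ r) : Transcript n i t :=
  fun s j => Q.dec i (fun k l => m ⟨k + G * s, (blockIndex_lt s.2 k.2).trans_le ht⟩ l) j

/-- The protocol in which every round of `S` is replaced by a run of the gadget. -/
def lift (Q : Gadget n G) (S : Simulation X R M) : Simulation X R (M * G) where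
  bit i a r m := Q.bit i
    (S.bit i a ⟨r / G, Nat.div_lt_of_lt_mul (r.2.trans_eq (Nat.mul_comm M G))⟩
      (Q.decodeBlocks i m (r / G) (Nat.div_mul_le_self _ _)))
    ⟨r % G, Nat.mod_lt _ (Nat.pos_of_ne_zero fun h => by
      exact Nat.not_lt_zero _ (r.2.trans_eq (by rw [h, Nat.mul_zero])))⟩
    (fun k l => m ⟨k + G * (r / G), (Nat.add_lt_add_right k.2 _).trans_eq (Nat.mod_add_div _ _)⟩ l)
  output i a m := S.output i a (Q.decodeBlocks i m M le_rfl)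

variable (Q : Gadget n G) (S : Simulation X R M) (x : ∀ i, X i) (e : Noise n (M * G))

/-- The bits that the parties put into the gadget in its `r`-th run. -/
def liftInput (r : Fin M) (i : Fin n) : Bool :=
  S.bit i (x i) r (Q.decodeBlocks i (fun s => (Q.lift S).received x e i
    ⟨s, s.2.trans_le (Nat.mul_le_mul_right G r.2.le)⟩ : Transcript n i (r * G)) r le_rfl)

lemma sent_lift (r : Fin M) (k : Fin G) (i : Fin n) :
    (Q.lift S).sent x e (finProdFinEquiv (r, k)) i =
      Q.toProtocol.sent (Q.liftInput S x e r) (block e r) k i := by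
  obtain ⟨k, hk⟩ := k
  induction k using Nat.strong_induction_on generalizing i with
  | _ k ih =>
    have hG : 0 < G := by omega
    have hdiv : (k + G * r) / G = r := by
      rw [Nat.add_mul_div_left _ _ hG, Nat.div_eq_of_lt hk, zero_add]
    have hmod : (k + G * r) % G = k := by
      rw [Nat.add_mul_mod_self_left, Nat.mod_eq_of_lt hk]
    rw [Protocol.sent, Protocol.sent]
    -- The indices `(k + G * r) / G` and `(k + G * r) % G` occur in the types of the transcripts;
    -- they are made variables so that they can be replaced by `r` and `k`.
    have gen : ∀ (t : ℕ) (ht : t < M) (u : ℕ) (hu : u < G) (m : Transcript n i t)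
        (m' : Transcript n i u), (htr : t = r) → (huk : u = k) →
        (∀ (s : ℕ) (h1 : s < t) (h2 : s < r) (j), m ⟨s, h1⟩ j = Q.decodeBlocks i
          (fun s => (Q.lift S).received x e i
            ⟨s, s.2.trans_le (Nat.mul_le_mul_right G r.2.le)⟩ : Transcript n i (r * G)) r le_rfl
          ⟨s, h2⟩ j) →
        (∀ (s : ℕ) (h1 : s < u) (h2 : s < k) (j), m' ⟨s, h1⟩ j =
          xor (Q.toProtocol.sent (Q.liftInput S x e r) (block e r) ⟨s, h2.trans hk⟩ j)
            (block e r (⟨s, h2.trans hk⟩, ⟨(j, i), j.2⟩))) →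
        Q.bit i (S.bit i (x i) ⟨t, ht⟩ m) ⟨u, hu⟩ m' = Q.toProtocol.bit i
          (Q.liftInput S x e r i) ⟨k, hk⟩ fun s j =>
          xor (Q.toProtocol.sent (Q.liftInput S x e r) (block e r) ⟨s, s.2.trans hk⟩ j)
            (block e r (⟨s, s.2.trans hk⟩, ⟨(j, i), j.2⟩)) := by
      rintro t ht u hu m m' rfl rfl hm hm'
      have h1 : m = _ := funext fun s => funext fun j => hm s s.2 s.2 j
      have h2 : m' = _ := funext fun s => funext fun j => hm' s s.2 s.2 j
      rw [h1, h2]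
      rfl
    refine gen _ _ _ _ _ _ hdiv hmod ?_ ?_
    · intro s h1 h2 j
      rfl
    · intro s h1 h2 j
      rw [← ih s h2 j (h2.trans hk)]
      have : finProdFinEquiv (r, (⟨s, h2.trans hk⟩ : Fin G)) =
          ⟨s + G * ((k + G * r) / G), by rw [hdiv]; exact blockIndex_lt r.2 (h2.trans hk)⟩ :=
        Fin.ext (by simp [hdiv])
      unfold block
      rw [this]
      rfl

/-- The noise of `S` that the noise `e` of the lifted protocol amounts to. -/
def liftNoise : Noise n M := fun c =>
  xor (Q.liftInput S x e c.1 c.2.1.1)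
    (Q.decodeBlocks c.2.1.2 ((Q.lift S).received x e c.2.1.2) M le_rfl c.1 ⟨c.2.1.1, c.2.2⟩)

lemma decodeBlocks_received (i : Fin n) (r : Fin M) (j : {j : Fin n // j ≠ i}) :
    Q.decodeBlocks i ((Q.lift S).received x e i) M le_rfl r j =
      Q.dec i (Q.toProtocol.received (Q.liftInput S x e r) (block e r) i) j := by
  unfold decodeBlocks
  congr 1
  funext k l
  unfold Protocol.received
  rw [← sent_lift]
  rfl

/-- `liftNoise` records the discrepancy between the input of a run and its decoded value. Adding it
to the input gives exactly what is decoded, so by induction on the round the lifted execution is an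
execution of `S`. -/
lemma sent_liftNoise (r : Fin M) (i : Fin n) :
    S.sent x (Q.liftNoise S x e) r i = Q.liftInput S x e r i := by
  obtain ⟨r, hr⟩ := r
  induction r using Nat.strong_induction_on generalizing i with
  | _ r ih =>
    rw [Protocol.sent, liftInput]
    congr 1
    funext s j
    rw [ih s s.2]
    simp only [liftNoise]
    rw [← Bool.xor_assoc, Bool.xor_self, Bool.false_xor]
    rfl

lemma received_liftNoise (i : Fin n) :
    S.received x (Q.liftNoise S x e) i =
      Q.decodeBlocks i ((Q.lift S).received x e i) M le_rfl := by
  funext r j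
  rw [Protocol.received, sent_liftNoise]
  simp only [liftNoise]
  rw [← Bool.xor_assoc, Bool.xor_self, Bool.false_xor]

lemma output_lift (i : Fin n) :
    (Q.lift S).output i (x i) ((Q.lift S).received x e i) =
      S.output i (x i) (S.received x (Q.liftNoise S x e) i) := by
  rw [received_liftNoise]
  rfl

lemma liftNoise_eq_false {r : Fin M} (h : Q.Reliable (block e r)) (l : Link n) :
    Q.liftNoise S x e (r, l) = false := by
  unfold liftNoise
  simp only
  rw [decodeBlocks_received, h, Bool.xor_self]

end Gadget

end Composition

/-! ### Block codes from tree codes -/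

section BlockCode

/-- Any two codewords of `enc` differ in at least a quarter of the positions. -/
def IsBlockCode {ι : Type} [Fintype ι] {s : ℕ} (enc : (ι → Bool) → ι → Fin s → Bool) : Prop :=
  ∀ u u', u ≠ u' → Fintype.card ι ≤ 4 * (Finset.univ.filter fun j => enc u j ≠ enc u' j).card

theorem exists_isBlockCode : ∃ s : ℕ, ∀ (ι : Type) [Fintype ι],
    ∃ enc : (ι → Bool) → ι → Fin s → Bool, IsBlockCode enc := by
  obtain ⟨s, hs⟩ := exists_isTreeCode Bool
  refine ⟨s + s, fun ι _ => ?_⟩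
  set m := Fintype.card ι
  obtain ⟨code, hcode⟩ := hs (2 * m)
  let φ : ι ≃ Fin m := Fintype.equivFin ι
  -- Padding to length `2 * m` leaves at least `m` positions after the first difference, hence `m /
  -- 2` differing labels. Symbol `j` carries the labels of times `j` and `j + m`, so at least `m /
  -- 4` symbols differ.
  let ext : (ι → Bool) → ℕ → Bool := fun u t => if h : t < m then u (φ.symm ⟨t, h⟩) else false
  refine ⟨fun u j => Fin.append (code (ext u) (φ j)) (code (ext u) (φ j + m)), fun u u' hne => ?_⟩
  set S := Finset.univ.filter fun j => Fin.append (code (ext u) (φ j)) (code (ext u) (φ j + m)) ≠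
    Fin.append (code (ext u') (φ j)) (code (ext u') (φ j + m)) with hS
  have hex : ∃ t, ext u t ≠ ext u' t := by
    obtain ⟨j, hj⟩ := Function.ne_iff.1 hne
    exact ⟨φ j, by simpa [ext] using hj⟩
  classical
  set d := Nat.find hex
  have hd : ext u d ≠ ext u' d := Nat.find_spec hex
  have hdm : d < m := by
    by_contra h
    exact hd (by simp [ext, h])
  have hdist := hcode.dist (ext u) (ext u') d (2 * m - d) (by omega)
    (fun i hi => not_not.1 (Nat.find_min hex hi)) hd
  have hmem : ∀ (t : ℕ) (j : ι), t = φ j ∨ t = φ j + m → code (ext u) t ≠ code (ext u') t →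
      j ∈ S := by
    intro t j ht hne
    refine Finset.mem_filter.2 ⟨Finset.mem_univ _, fun heq => hne ?_⟩
    rcases ht with rfl | rfl
    · funext k
      simpa using congrFun heq (Fin.castAdd s k)
    · funext k
      simpa only [Fin.append_right] using congrFun heq (Fin.natAdd s k)
  have hsub : {t | d ≤ t ∧ t < d + (2 * m - d) ∧ code (ext u) t ≠ code (ext u') t} ⊆
      ((S.image fun j => (φ j : ℕ)) ∪ (S.image fun j => (φ j : ℕ) + m) : Finset ℕ) := by
    rintro t ⟨-, ht, hne⟩
    rw [Finset.mem_coe, Finset.mem_union, Finset.mem_image, Finset.mem_image]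
    rcases Nat.lt_or_ge t m with h | h
    · exact Or.inl ⟨φ.symm ⟨t, h⟩, hmem t _ (Or.inl (by simp)) hne, by simp⟩
    · have h' : t - m < m := by omega
      have h'' : t = (φ (φ.symm ⟨t - m, h'⟩) : ℕ) + m := by simp; omega
      exact Or.inr ⟨φ.symm ⟨t - m, h'⟩, hmem t _ (Or.inr h'') hne, h''.symm⟩
  have h1 := Set.ncard_le_ncard hsub (Finset.finite_toSet _)
  rw [Set.ncard_coe_finset] at h1
  have h2 := Finset.card_union_le (S.image fun j => (φ j : ℕ)) (S.image fun j => (φ j : ℕ) + m)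
  have h3 : (S.image fun j => (φ j : ℕ)).card ≤ S.card := Finset.card_image_le
  have h4 : (S.image fun j => (φ j : ℕ) + m).card ≤ S.card := Finset.card_image_le
  omega

/-- A word whose codeword is closest to `y`. -/
noncomputable def decodeBlock {ι : Type} [Fintype ι] {s : ℕ}
    (enc : (ι → Bool) → ι → Fin s → Bool) (y : ι → Fin s → Bool) : ι → Bool :=
  Function.argmin fun u => (Finset.univ.filter fun j => enc u j ≠ y j).card

lemma IsBlockCode.decodeBlock_eq {ι : Type} [Fintype ι] {s : ℕ}
    {enc : (ι → Bool) → ι → Fin s → Bool} (henc : IsBlockCode enc) {y : ι → Fin s → Bool}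
    {u : ι → Bool} (h : 8 * (Finset.univ.filter fun j => enc u j ≠ y j).card < Fintype.card ι) :
    decodeBlock enc y = u := by
  classical
  by_contra hne
  have h1 := henc _ _ hne
  have h2 : (Finset.univ.filter fun j => enc (decodeBlock enc y) j ≠ y j).card ≤
      (Finset.univ.filter fun j => enc u j ≠ y j).card :=
    Function.argmin_le (fun u => (Finset.univ.filter fun j => enc u j ≠ y j).card) u
  have h3 : (Finset.univ.filter fun j => enc (decodeBlock enc y) j ≠ enc u j).card ≤
      (Finset.univ.filter fun j => enc (decodeBlock enc y) j ≠ y j).card +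
        (Finset.univ.filter fun j => enc u j ≠ y j).card := by
    refine (Finset.card_le_card fun j hj => ?_).trans (Finset.card_union_le _ _)
    simp only [Finset.mem_filter, Finset.mem_union, Finset.mem_univ, true_and] at hj ⊢
    by_contra h
    push Not at h
    exact hj (h.1.trans h.2.symm)
  omega

end BlockCode

/-! ### Majority decoding -/

section Majority

/-- The majority of the bits `f`. -/
def majority {ρ : ℕ} (f : Fin ρ → Bool) : Bool :=
  decide (ρ < 2 * (Finset.univ.filter fun a => f a = true).card)

lemma majority_xor {ρ : ℕ} {g : Fin ρ → Bool} (hg : ¬ MajorityFlipped g) (b : Bool) :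
    majority (fun a => xor b (g a)) = b := by
  unfold MajorityFlipped at hg
  unfold majority
  cases b
  · simp only [Bool.false_xor]
    exact decide_eq_false (by omega)
  · have h := Finset.card_filter_add_card_filter_not (s := (Finset.univ : Finset (Fin ρ)))
      (fun a => g a = true)
    rw [Finset.card_univ, Fintype.card_fin] at h
    simp only [Bool.true_xor, Bool.not_eq_true', ← Bool.not_eq_true]
    exact decide_eq_true (by omega)

end Majority

/-! ### Correctness of Gallager's protocol -/

section Gallager

variable {n ρ s : ℕ} {grp : Fin n → ℕ}

/-- The members of the `γ`-th group. -/
abbrev Group (grp : Fin n → ℕ) (γ : ℕ) : Type := {j : Fin n // grp j = γ}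

/-- The word of bits of its group that party `i` decodes from the first `ρ` rounds. -/
def groupWord (ρ : ℕ) (grp : Fin n → ℕ) (i : Fin n) (b : Bool) {r : ℕ} (m : Transcript n i r) :
    Group grp (grp i) → Bool := fun j =>
  if h : j.1 = i then b else
    majority fun a : Fin ρ => if h' : a < r then m ⟨a, h'⟩ ⟨j, h⟩ else false

/-- The symbols of the codeword of the `γ`-th group that party `i` receives. -/
def groupSymbols (grp : Fin n → ℕ) (i : Fin n) (m : Transcript n i ((s + 1) * ρ)) (γ : ℕ) :
    Group grp γ → Fin s → Bool := fun l k =>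
  if h : l.1 = i then false else majority fun a => m (finProdFinEquiv (k.succ, a)) ⟨l, h⟩

/-- Gallager's protocol: the parties broadcast their bits `ρ` times, and then `ρ` times their
symbols in the codeword of the word of bits of their group. -/
noncomputable def gallager (ρ : ℕ) (grp : Fin n → ℕ)
    (enc : ∀ γ, (Group grp γ → Bool) → Group grp γ → Fin s → Bool) : Gadget n ((s + 1) * ρ) where
  bit i b r m := Fin.cases (motive := fun _ => Bool) b
    (fun k => enc (grp i) (groupWord ρ grp i b m) ⟨i, rfl⟩ k) (finProdFinEquiv.symm r).1
  dec i m j := decodeBlock (enc (grp j)) (groupSymbols grp i m (grp j)) ⟨j, rfl⟩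

/-- The bit sent over `l` in all rounds of phase `p` is received wrongly at least half the time. -/
def BadCopy (e : Noise n ((s + 1) * ρ)) (p : Fin (s + 1)) (l : Link n) : Prop :=
  MajorityFlipped fun a => e (finProdFinEquiv (p, a), l)

/-- Party `l` may decode its group word wrongly, or `i` may decode the symbol of `l` wrongly. -/
def BadSender (grp : Fin n → ℕ) (e : Noise n ((s + 1) * ρ)) (i l : Fin n) : Prop :=
  (∃ l', ∃ h : l' ≠ l, grp l' = grp l ∧ BadCopy e 0 ⟨(l', l), h⟩) ∨
    ∃ k : Fin s, ∃ h : l ≠ i, BadCopy e k.succ ⟨(l, i), h⟩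

variable {enc : ∀ γ, (Group grp γ → Bool) → Group grp γ → Fin s → Bool}
  (b : Fin n → Bool) (e : Noise n ((s + 1) * ρ))

lemma sent_gallager_zero (a : Fin ρ) (i : Fin n) :
    (gallager ρ grp enc).toProtocol.sent b e (finProdFinEquiv (0, a)) i = b i := by
  rw [Protocol.sent]
  simp only [Gadget.toProtocol, gallager, Equiv.symm_apply_apply, Fin.cases_zero]

/-- If all majorities of the first phase are right at `i`, then `i` encodes the true word of its
group. -/
lemma sent_gallager_succ (k : Fin s) (a : Fin ρ) (i : Fin n)
    (hi : ∀ l', ∀ h : l' ≠ i, grp l' = grp i → ¬ BadCopy e 0 ⟨(l', i), h⟩) :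
    (gallager ρ grp enc).toProtocol.sent b e (finProdFinEquiv (k.succ, a)) i =
      enc (grp i) (fun j => b j.1) ⟨i, rfl⟩ k := by
  rw [Protocol.sent]
  simp only [Gadget.toProtocol, gallager, Equiv.symm_apply_apply, Fin.cases_succ]
  congr 1
  funext j
  unfold groupWord
  split_ifs with hj
  · rw [hj]
  · rw [← majority_xor (hi j hj j.2) (b j)]
    congr 1
    funext a'
    have hlt : (a' : ℕ) < (finProdFinEquiv (k.succ, a) : Fin ((s + 1) * ρ)) := by
      simp only [finProdFinEquiv_apply_val, Fin.val_succ]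
      have h1 := a'.2
      have h2 : ρ * 1 ≤ ρ * (k + 1) := Nat.mul_le_mul_left _ (by omega)
      omega
    rw [dif_pos hlt]
    have h0 := sent_gallager_zero (enc := enc) b e a' j
    have heq : (finProdFinEquiv (0, a') : Fin ((s + 1) * ρ)) =
        ⟨a', hlt.trans (finProdFinEquiv (k.succ, a)).2⟩ := Fin.ext (by simp)
    rw [heq] at h0
    rw [heq, ← h0]
    rfl

lemma groupSymbols_gallager (i : Fin n) (γ : ℕ) (l : Group grp γ) (hli : l.1 ≠ i)
    (hl : ¬ BadSender grp e i l) :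
    enc γ (fun j => b j.1) l = groupSymbols grp i
      ((gallager ρ grp enc).toProtocol.received b e i) γ l := by
  obtain ⟨l, rfl⟩ := l
  unfold BadSender at hl
  push Not at hl
  funext k
  simp only at hli
  rw [groupSymbols, dif_neg hli, ← majority_xor (hl.2 k hli) (enc (grp l) (fun j => b j.1) ⟨l, rfl⟩ k)]
  congr 1
  funext a
  rw [Protocol.received, sent_gallager_succ b e k a l hl.1]

open scoped Classical in
lemma reliable_gallager (henc : ∀ γ, IsBlockCode (enc γ))
    (h16 : ∀ j, 16 ≤ (Finset.univ.filter fun l => grp l = grp j).card)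
    (he : ∀ i j, 16 * ((Finset.univ.filter fun l => grp l = grp j).filter
      fun l => BadSender grp e i l).card < (Finset.univ.filter fun l => grp l = grp j).card) :
    (gallager ρ grp enc).Reliable e := by
  intro b i j
  have hcard : Fintype.card (Group grp (grp j)) =
      (Finset.univ.filter fun l => grp l = grp j).card := Fintype.card_subtype _
  have key : decodeBlock (enc (grp j)) (groupSymbols grp i
      ((gallager ρ grp enc).toProtocol.received b e i) (grp j)) = fun l => b l.1 := by
    refine (henc _).decodeBlock_eq ?_
    -- The extra `1` is for the receiver `i`, which may lie in the group and receives no symbol from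
    -- itself. The group has at least `16` members, so the error fraction stays below the decoding
    -- radius `1 / 8`.
    have hle : (Finset.univ.filter fun l => enc (grp j) (fun l => b l.1) l ≠ groupSymbols grp i
        ((gallager ρ grp enc).toProtocol.received b e i) (grp j) l).card ≤
        ((Finset.univ.filter fun l => grp l = grp j).filter
          fun l => BadSender grp e i l).card + 1 := by
      rw [← Finset.card_map (Function.Embedding.subtype _)]
      refine (Finset.card_le_card (t := insert i ((Finset.univ.filter fun l => grp l =
        grp j).filter fun l => BadSender grp e i l)) fun l hl => ?_).trans (Finset.card_insert_le _ _)
      obtain ⟨l, hl', rfl⟩ := Finset.mem_map.1 hl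
      by_contra hnot
      rw [Finset.mem_insert, Finset.mem_filter, Finset.mem_filter] at hnot
      push Not at hnot
      exact (Finset.mem_filter.1 hl').2 (groupSymbols_gallager b e i _ l hnot.1
        (hnot.2 ⟨Finset.mem_univ _, l.2⟩))
    have h1 := h16 j
    have h2 := he i j
    omega
  exact congrFun key ⟨j, rfl⟩

end Gallager

/-! ### Failure probability of Gallager's protocol -/

section GallagerProbability

variable {n ρ s : ℕ} {grp : Fin n → ℕ} {ε : unitInterval}

lemma measureReal_badCopy_le (hε : (ε : ℝ) < 1 / 2) (p : Fin (s + 1)) (l : Link n) :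
    (noiseLaw n ((s + 1) * ρ) ε).real {e | BadCopy e p l} ≤ decayRate ε ^ ρ :=
  pi_real_majorityFlipped_le hε (fun a => (finProdFinEquiv (p, a), l)) fun a a' h => by
    simpa using h

instance (n R : ℕ) (ε : unitInterval) : IsProbabilityMeasure (noiseLaw n R ε) := by
  unfold noiseLaw; infer_instance

lemma measureReal_badSender_le (hε : (ε : ℝ) < 1 / 2) (i l : Fin n) :
    (noiseLaw n ((s + 1) * ρ) ε).real {e | BadSender grp e i l} ≤
      ((Finset.univ.filter fun l' => grp l' = grp l).card + s) * decayRate ε ^ ρ := by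
  have hκ : 0 ≤ decayRate ε ^ ρ := pow_nonneg (decayRate_pos hε).le _
  let A : Fin n → Set (Noise n ((s + 1) * ρ)) := fun l' => {e | ∃ h : l' ≠ l, BadCopy e 0 ⟨(l', l), h⟩}
  let B : Fin s → Set (Noise n ((s + 1) * ρ)) := fun k =>
    {e | ∃ h : l ≠ i, BadCopy e k.succ ⟨(l, i), h⟩}
  have hA : ∀ l', (noiseLaw n ((s + 1) * ρ) ε).real (A l') ≤ decayRate ε ^ ρ := by
    intro l'
    by_cases h : l' = l
    · simpa [A, h] using hκ
    · refine le_trans (measureReal_mono ?_ (measure_ne_top _ _))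
        (measureReal_badCopy_le hε 0 ⟨(l', l), h⟩)
      rintro e ⟨_, he⟩
      exact he
  have hB : ∀ k, (noiseLaw n ((s + 1) * ρ) ε).real (B k) ≤ decayRate ε ^ ρ := by
    intro k
    by_cases h : l = i
    · simpa [B, h] using hκ
    · refine le_trans (measureReal_mono ?_ (measure_ne_top _ _))
        (measureReal_badCopy_le hε k.succ ⟨(l, i), h⟩)
      rintro e ⟨_, he⟩
      exact he
  have hsub : {e | BadSender grp e i l} ⊆
      (⋃ l' ∈ Finset.univ.filter (fun l' => grp l' = grp l), A l') ∪ ⋃ k ∈ Finset.univ, B k := by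
    rintro e (⟨l', h, hg, he⟩ | ⟨k, h, he⟩)
    · exact Or.inl (Set.mem_biUnion (x := l') (by simpa using hg) ⟨h, he⟩)
    · exact Or.inr (Set.mem_biUnion (x := k) (by simp) ⟨h, he⟩)
  refine (measureReal_mono hsub (measure_ne_top _ _)).trans ((measureReal_union_le _ _).trans ?_)
  refine le_of_le_of_eq ?_ (add_mul _ _ _).symm
  refine add_le_add ((measureReal_biUnion_finset_le _ _).trans ?_)
    ((measureReal_biUnion_finset_le _ _).trans ?_)
  · simpa using Finset.sum_le_card_nsmul _ _ _ fun l' _ => hA l'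
  · simpa using Finset.sum_le_card_nsmul Finset.univ _ _ fun k _ => hB k

/-- The noise bits that decide on whether `l` is a bad sender for `i`. -/
def senderCoords (ρ s : ℕ) (i l : Fin n) : Set (Fin ((s + 1) * ρ) × Link n) :=
  {c | ((finProdFinEquiv.symm c.1).1 = 0 ∧ c.2.1.2 = l) ∨
    ((finProdFinEquiv.symm c.1).1 ≠ 0 ∧ c.2.1 = (l, i))}

lemma dependsOn_badSender (i l : Fin n) :
    DependsOn (· ∈ {e : Noise n ((s + 1) * ρ) | BadSender grp e i l}) (senderCoords ρ s i l) := by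
  intro e e' h
  have h0 : ∀ l' (hl : l' ≠ l), BadCopy e 0 ⟨(l', l), hl⟩ ↔ BadCopy e' 0 ⟨(l', l), hl⟩ := by
    intro l' hl
    unfold BadCopy
    have : (fun a => e (finProdFinEquiv (0, a), ⟨(l', l), hl⟩)) =
        fun a => e' (finProdFinEquiv (0, a), ⟨(l', l), hl⟩) :=
      funext fun a => h _ (Or.inl ⟨by simp, rfl⟩)
    rw [this]
  have h1 : ∀ (k : Fin s) (hl : l ≠ i),
      BadCopy e k.succ ⟨(l, i), hl⟩ ↔ BadCopy e' k.succ ⟨(l, i), hl⟩ := by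
    intro k hl
    unfold BadCopy
    have : (fun a => e (finProdFinEquiv (k.succ, a), ⟨(l, i), hl⟩)) =
        fun a => e' (finProdFinEquiv (k.succ, a), ⟨(l, i), hl⟩) :=
      funext fun a => h _ (Or.inr ⟨by simp, rfl⟩)
    rw [this]
  simp only [Set.mem_ofPred_eq, BadSender, h0, h1]

/-- First-phase coordinates are told apart by their receiver `l`, later ones by their sender `l`.
This makes the senders bad independently for a fixed receiver `i`. -/
lemma pairwiseDisjoint_senderCoords (i : Fin n) (A : Set (Fin n)) :
    A.PairwiseDisjoint (senderCoords ρ s i) := by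
  intro l _ l' _ hne
  refine Set.disjoint_left.2 fun c hc hc' => ?_
  rcases hc with ⟨h1, h2⟩ | ⟨h1, h2⟩ <;> rcases hc' with ⟨h3, h4⟩ | ⟨h3, h4⟩
  · exact hne (h2.symm.trans h4)
  · exact h3 h1
  · exact h1 h3
  · exact hne (congrArg Prod.fst (h2.symm.trans h4))

lemma measureReal_not_reliable_le (hε : (ε : ℝ) < 1 / 2)
    {enc : ∀ γ, (Group grp γ → Bool) → Group grp γ → Fin s → Bool}
    (henc : ∀ γ, IsBlockCode (enc γ)) {L : ℕ} (hL : 16 ≤ L)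
    (hlow : ∀ j, L ≤ (Finset.univ.filter fun l => grp l = grp j).card)
    (hup : ∀ j, (Finset.univ.filter fun l => grp l = grp j).card ≤ 2 * L)
    {ζ : ℝ} (hζ : 0 ≤ ζ) (hζ' : 2 * ζ ≤ 1) (hρ : (2 * L + s) * decayRate ε ^ ρ ≤ ζ ^ 16) :
    (noiseLaw n ((s + 1) * ρ) ε).real {e | ¬ (gallager ρ grp enc).Reliable e} ≤
      n ^ 2 * (2 * ζ) ^ L := by
  classical
  let E : Fin n × Fin n → Set (Noise n ((s + 1) * ρ)) := fun q =>
    {e | (Finset.univ.filter fun l => grp l = grp q.2).card ≤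
      16 * ((Finset.univ.filter fun l => grp l = grp q.2).filter
        fun l => BadSender grp e q.1 l).card}
  have hsub : {e | ¬ (gallager ρ grp enc).Reliable e} ⊆ ⋃ q ∈ Finset.univ, E q := by
    intro e he
    by_contra hnot
    refine he (reliable_gallager e henc (fun j => hL.trans (hlow j)) fun i j => ?_)
    by_contra hle
    exact hnot (Set.mem_biUnion (x := (i, j)) (by simp) (not_lt.1 hle))
  have hE : ∀ q, (noiseLaw n ((s + 1) * ρ) ε).real (E q) ≤ (2 * ζ) ^ L := by
    intro q
    set g := Finset.univ.filter fun l => grp l = grp q.2 with hg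
    -- `k` is a sixteenth of the group size, rounded up; the power `16` in the bound `ζ ^ 16` for
    -- one bad sender compensates for it.
    have hk : ∃ k, g.card ≤ 16 * k ∧ 16 * k < g.card + 16 := ⟨(g.card + 15) / 16, by omega, by omega⟩
    obtain ⟨k, hk1, hk2⟩ := hk
    have hsub' : E q ⊆ {e | k ≤ (g.filter fun l => e ∈ {e | BadSender grp e q.1 l}).card} := by
      intro e he
      have he : g.card ≤ 16 * (g.filter fun l => BadSender grp e q.1 l).card := he
      simp only [Set.mem_ofPred_eq]
      omega
    refine (measureReal_mono hsub' (measure_ne_top _ _)).trans ?_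
    have hq : ∀ l ∈ g, (noiseLaw n ((s + 1) * ρ) ε).real {e | BadSender grp e q.1 l} ≤ ζ ^ 16 := by
      intro l hl
      refine (measureReal_badSender_le hε q.1 l).trans (le_trans ?_ hρ)
      have := hup l
      have hκ : 0 ≤ decayRate ε ^ ρ := pow_nonneg (decayRate_pos hε).le _
      gcongr
      exact_mod_cast this
    refine (pi_real_card_ge_le _ g k (fun l _ => dependsOn_badSender q.1 l)
      (pairwiseDisjoint_senderCoords q.1 _) hq (by positivity)).trans ?_
    calc 2 ^ g.card * (ζ ^ 16) ^ k = 2 ^ g.card * ζ ^ (16 * k) := by rw [pow_mul]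
      _ ≤ 2 ^ g.card * ζ ^ g.card := by
        refine mul_le_mul_of_nonneg_left ?_ (by positivity)
        exact pow_le_pow_of_le_one hζ (by linarith) hk1
      _ = (2 * ζ) ^ g.card := (mul_pow _ _ _).symm
      _ ≤ (2 * ζ) ^ L := pow_le_pow_of_le_one (by positivity) hζ' (hlow q.2)
  refine (measureReal_mono hsub (measure_ne_top _ _)).trans
    ((measureReal_biUnion_finset_le _ _).trans ?_)
  refine (Finset.sum_le_card_nsmul _ _ _ fun q _ => hE q).trans (le_of_eq ?_)
  simp [sq]

end GallagerProbability

/-! ### Choice of the group size and the number of repetitions -/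

lemma exists_grouping {n L : ℕ} (hL : 0 < L) (hLn : L ≤ n) : ∃ grp : Fin n → ℕ, ∀ j,
    L ≤ (Finset.univ.filter fun l => grp l = grp j).card ∧
      (Finset.univ.filter fun l => grp l = grp j).card ≤ 2 * L := by
  -- Consecutive intervals of length `L`, the last of which absorbs the remainder.
  refine ⟨fun i => min (i / L) (n / L - 1), fun j => ?_⟩
  set γ := min ((j : ℕ) / L) (n / L - 1) with hγ
  have hn1 : 1 ≤ n / L := (Nat.one_le_div_iff hL).2 hLn
  have hγn : (γ + 1) * L ≤ n :=
    calc (γ + 1) * L ≤ n / L * L := Nat.mul_le_mul_right _ (by omega)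
      _ ≤ n := Nat.div_mul_le_self n L
  rw [Nat.add_mul, one_mul] at hγn
  constructor
  · let f : Fin L → Fin n := fun a => ⟨a + L * γ, by
      have := a.2; rw [Nat.mul_comm L γ]; omega⟩
    have hf : f.Injective := fun a a' h => by
      have := congrArg Fin.val h
      simp only [f] at this
      exact Fin.ext (by omega)
    calc L = (Finset.univ.image f).card := by
          rw [Finset.card_image_of_injective _ hf, Finset.card_univ, Fintype.card_fin]
      _ ≤ _ := Finset.card_le_card fun i hi => by
          obtain ⟨a, -, rfl⟩ := Finset.mem_image.1 hi
          rw [Finset.mem_filter]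
          refine ⟨Finset.mem_univ _, ?_⟩
          have : ((f a : Fin n) : ℕ) / L = γ := by
            simp only [f]
            rw [Nat.add_mul_div_left _ _ hL, Nat.div_eq_of_lt a.2, zero_add]
          simp only [this]
          omega
  · rw [← Finset.card_image_of_injective _ Fin.val_injective]
    have hcard : (Finset.Ico (γ * L) (γ * L + 2 * L)).card = 2 * L := by simp
    refine (Finset.card_le_card fun i hi => ?_).trans_eq hcard
    obtain ⟨i, hi', rfl⟩ := Finset.mem_image.1 hi
    have hi : min ((i : ℕ) / L) (n / L - 1) = γ := (Finset.mem_filter.1 hi').2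
    rw [Finset.mem_Ico]
    refine ⟨(Nat.le_div_iff_mul_le hL).1 (by omega), ?_⟩
    have hlt : (i : ℕ) / L < γ + 2 := by
      have : (i : ℕ) / L ≤ n / L := Nat.div_le_div_right i.2.le
      omega
    have := (Nat.div_lt_iff_lt_mul hL).1 hlt
    rwa [Nat.add_mul] at this

lemma tendsto_log_natCast : Tendsto (fun n : ℕ => Real.log n) atTop atTop :=
  Real.tendsto_log_atTop.comp tendsto_natCast_atTop_atTop

lemma exists_repetitions {ε : unitInterval} (hε : (ε : ℝ) < 1 / 2) (s : ℕ) {η : ℝ} (hη : 0 < η) :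
    ∃ C : ℝ, 0 ≤ C ∧ ∀ᶠ n : ℕ in atTop, ∃ ρ : ℕ,
      (2 * ((Nat.log 2 n + 1 : ℕ) : ℝ) + s) * decayRate ε ^ ρ ≤ η ∧
        (ρ : ℝ) ≤ C * Real.log (Real.log n) := by
  set lam := -Real.log (decayRate ε) with hlam
  have hκ := decayRate_pos hε
  have hlam0 : 0 < lam := neg_pos.2 (Real.log_neg hκ (decayRate_lt_one hε))
  refine ⟨2 / lam + 1, by positivity, ?_⟩
  filter_upwards [tendsto_log_natCast.eventually_ge_atTop ((6 + s) / η),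
    (Real.tendsto_log_atTop.comp tendsto_log_natCast).eventually_ge_atTop 1,
    tendsto_log_natCast.eventually_ge_atTop 1, eventually_gt_atTop 0] with n h1 h2 h3 hn
  simp only [Function.comp_apply] at h2
  set l := Real.log n with hl
  have hl0 : 0 < l := by linarith
  -- This many repetitions bring the error down to `1 / l ^ 2`, which beats the factor of order `l`.
  -- Rounding up costs at most `log l ≥ 1`, the `+ 1` in the constant.
  refine ⟨⌈2 * Real.log l / lam⌉₊, ?_, ?_⟩
  · have hpow : decayRate ε ^ ⌈2 * Real.log l / lam⌉₊ ≤ 1 / l ^ 2 := by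
      have hceil := Nat.le_ceil (2 * Real.log l / lam)
      rw [div_le_iff₀ hlam0] at hceil
      rw [← Real.log_le_log_iff (by positivity) (by positivity), Real.log_pow, one_div,
        Real.log_inv, Real.log_pow]
      push_cast
      nlinarith
    have hL : ((Nat.log 2 n + 1 : ℕ) : ℝ) ≤ 3 * l := by
      have h4 : (Nat.log 2 n : ℝ) * Real.log 2 ≤ l := by
        rw [← Real.log_pow]
        refine Real.log_le_log (by positivity) ?_
        exact_mod_cast Nat.pow_log_le_self 2 hn.ne'
      have h5 := Real.log_two_gt_d9
      have h6 : (0 : ℝ) ≤ Nat.log 2 n := Nat.cast_nonneg _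
      push_cast
      nlinarith
    have hs : (0 : ℝ) ≤ s := Nat.cast_nonneg s
    calc (2 * ((Nat.log 2 n + 1 : ℕ) : ℝ) + s) * decayRate ε ^ ⌈2 * Real.log l / lam⌉₊
        ≤ ((6 + s) * l) * (1 / l ^ 2) := by
          refine mul_le_mul ?_ hpow (by positivity) (by positivity)
          nlinarith
      _ = (6 + s) / l := by field_simp
      _ ≤ η := by
          rw [div_le_iff₀ hl0]
          rwa [div_le_iff₀ hη, mul_comm] at h1
  · have hpos : 0 ≤ 2 * Real.log l / lam := by positivity
    have := Nat.ceil_lt_add_one hpos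
    have e : 2 * Real.log l / lam = 2 / lam * Real.log l := by ring
    rw [e] at this ⊢
    linarith

/-- For large `n`, one round of the noiseless link can be replaced by `O(log log n)` rounds of the
noisy one. -/
lemma exists_reliable_gadget (ε : unitInterval) (hε : (ε : ℝ) < 1 / 2) :
    ∃ C : ℝ, 0 ≤ C ∧ ∀ᶠ n : ℕ in atTop, ∃ (G : ℕ) (Q : Gadget n G),
      (G : ℝ) ≤ C * Real.log (Real.log n) ∧
        (noiseLaw n G ε).real {e | ¬ Q.Reliable e} ≤ ((n : ℝ)⁻¹) ^ 16 := by
  obtain ⟨s, hs⟩ := exists_isBlockCode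
  -- For `ζ = 2⁻¹⁹` and `L = Nat.log 2 n + 1` one has `(2 * ζ) ^ L ≤ n⁻¹⁸`, and the union bound over
  -- pairs of parties costs `n ^ 2`.
  obtain ⟨C, hC, hev⟩ := exists_repetitions hε s (η := ((1 / 2 : ℝ) ^ 19) ^ 16) (by positivity)
  refine ⟨(s + 1) * C, by positivity, ?_⟩
  filter_upwards [hev, eventually_ge_atTop (2 ^ 15)] with n ⟨ρ, hρ, hρC⟩ hn
  have hL : 16 ≤ Nat.log 2 n + 1 := by
    have := (Nat.le_log_iff_pow_le (b := 2) (by norm_num) (by omega)).2 hn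
    omega
  have hn0 : n ≠ 0 := by omega
  obtain ⟨grp, hgrp⟩ := exists_grouping (n := n) (L := Nat.log 2 n + 1) (by omega)
    (Nat.log_lt_self 2 hn0)
  choose enc henc using fun γ : ℕ => hs (Group grp γ)
  refine ⟨(s + 1) * ρ, gallager ρ grp enc, ?_, ?_⟩
  · push_cast
    rw [mul_assoc]
    gcongr
  · refine (measureReal_not_reliable_le hε henc hL (fun j => (hgrp j).1) (fun j => (hgrp j).2)
      (ζ := (1 / 2) ^ 19) (by positivity) (by norm_num) hρ).trans ?_
    have hlt : (n : ℝ) ≤ 2 ^ (Nat.log 2 n + 1) := by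
      exact_mod_cast (Nat.lt_pow_succ_log_self (by norm_num) n).le
    have hn1 : (0 : ℝ) < n := by positivity
    calc (n : ℝ) ^ 2 * (2 * (1 / 2) ^ 19) ^ (Nat.log 2 n + 1)
        = (n : ℝ) ^ 2 * ((2 ^ (Nat.log 2 n + 1))⁻¹) ^ 18 := by
          rw [inv_pow, ← pow_mul, Nat.mul_comm, pow_mul, ← inv_pow]
          norm_num
      _ ≤ (n : ℝ) ^ 2 * ((n : ℝ)⁻¹) ^ 18 := by gcongr
      _ = ((n : ℝ)⁻¹) ^ 16 := by field_simp

/-! ### The composed simulation on random noise -/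

section Lift

variable {n G M R : ℕ} {X : Fin n → Type u} {ε : unitInterval}

/-- If few runs of the gadget fail, the lifted simulation behaves like the original one on a noise
pattern with few noisy rounds. -/
lemma Gadget.succeeds_lift (Q : Gadget n G) {S : Simulation X R M} {P : Protocol X R}
    {x : ∀ i, X i} {k : ℕ}
    (hS : ∀ e : Noise n M, (Finset.univ.filter fun r => ∃ l, e (r, l) = true).card ≤ k →
      S.Succeeds P x e)
    {e : Noise n (M * G)} [DecidablePred fun r => ¬ Q.Reliable (block e r)]
    (he : (Finset.univ.filter fun r : Fin M => ¬ Q.Reliable (block e r)).card ≤ k) :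
    (Q.lift S).Succeeds P x e := by
  intro i
  rw [Q.output_lift]
  refine hS _ ((Finset.card_le_card fun r hr => ?_).trans he) i
  obtain ⟨l, hl⟩ := (Finset.mem_filter.1 hr).2
  refine Finset.mem_filter.2 ⟨Finset.mem_univ _, fun hrel => ?_⟩
  rw [Q.liftNoise_eq_false S x e hrel l] at hl
  exact Bool.false_ne_true hl

-- `Reliable` quantifies over all inputs, so it depends only on the noise of its own block. Runs
-- thus fail independently, although their actual inputs depend on earlier noise.
open scoped Classical in
lemma Gadget.measureReal_card_not_reliable_le (Q : Gadget n G) {q : ℝ} (k : ℕ)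
    (hQ : (noiseLaw n G ε).real {e | ¬ Q.Reliable e} ≤ q) :
    (noiseLaw n (M * G) ε).real {e | k ≤ (Finset.univ.filter
      fun r : Fin M => ¬ Q.Reliable (block e r)).card} ≤ 2 ^ M * q ^ k := by
  have h := pi_real_card_ge_le (κ := Fin (M * G) × Link n) (bernoulliMeasure true false ε)
    (E := fun r : Fin M => {e | ¬ Q.Reliable (block e r)})
    (S := fun r => {c | (finProdFinEquiv.symm c.1).1 = r}) (q := q) Finset.univ k ?_ ?_ ?_
    (measureReal_nonneg.trans hQ)
  · rw [Finset.card_univ, Fintype.card_fin] at h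
    convert h
    rfl
  · intro r _ e e' hee
    have : block e r = block e' r := funext fun c =>
      hee _ (congrArg Prod.fst (finProdFinEquiv.symm_apply_apply (r, c.1)))
    simp only [Set.mem_ofPred_eq, this]
  · intro r _ r' _ hne
    exact Set.disjoint_left.2 fun c hc hc' => hne (hc.symm.trans hc')
  · intro r _
    refine (pi_real_comp (bernoulliMeasure true false ε)
      (fun c : Fin G × Link n => (finProdFinEquiv (r, c.1), c.2)) (fun c c' h => ?_)
      {e | ¬ Q.Reliable e}).trans_le hQ
    simpa [Prod.ext_iff] using h

end Lift

end BroadcastLink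

/-! ### Assembly -/

theorem corollary1 (ε : unitInterval) (hε : (ε : ℝ) < 1 / 2) :
    ∃ (C : ℝ) (δ : ℕ → ℝ), Tendsto δ atTop (𝓝 0) ∧
      ∀ (n : ℕ), 3 ≤ n → ∀ (X : Fin n → Type u) (R : ℕ) (P : BroadcastLink.Protocol X R),
        ∃ (T : ℕ) (S : BroadcastLink.Simulation X R T),
          (T : ℝ) ≤ C * (R * Real.log (Real.log n)) ∧
          ∀ x : ∀ i, X i,
            (BroadcastLink.noiseLaw n T ε).real {e | ¬ S.Succeeds P x e} ≤ δ n := by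
  classical
  obtain ⟨s, hs⟩ := BroadcastLink.exists_isTreeCode (Option Bool)
  obtain ⟨C, hC, hev⟩ := BroadcastLink.exists_reliable_gadget ε hε
  obtain ⟨n₀, hn₀⟩ := eventually_atTop.1 (hev.and (eventually_ge_atTop (4 ^ s)))
  refine ⟨2 * s * C, fun n => if n₀ ≤ n then (n : ℝ)⁻¹ else 1, ?_, fun n hn X R P => ?_⟩
  · refine tendsto_inv_atTop_nhds_zero_nat.congr' ?_
    filter_upwards [eventually_ge_atTop n₀] with n h
    rw [if_pos h]
  have hn1 : (1 : ℝ) ≤ Real.log n := by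
    rw [Real.le_log_iff_exp_le (by positivity)]
    have h3 : (3 : ℝ) ≤ n := by exact_mod_cast hn
    exact Real.exp_one_lt_three.le.trans h3
  have hloglog : 0 ≤ Real.log (Real.log n) := Real.log_nonneg hn1
  by_cases hlarge : n₀ ≤ n
  swap
  -- For small `n` the error bound is `1`, and a simulation without rounds will do.
  · refine ⟨0, ⟨⟨fun _ _ r _ => r.elim0⟩, fun _ _ _ => (fun _ => false, fun _ _ => false)⟩, ?_,
      fun x => ?_⟩
    · rw [Nat.cast_zero]
      positivity
    · simp only [if_neg hlarge]
      exact measureReal_le_one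
  obtain ⟨⟨G, Q, hG, hQ⟩, h4⟩ := hn₀ n hlarge
  obtain ⟨code, hcode⟩ := hs (2 * R)
  refine ⟨_, Q.lift (BroadcastLink.robustSim P code), ?_, fun x => ?_⟩
  · push_cast
    calc (2 * R * s * G : ℝ) ≤ 2 * R * s * (C * Real.log (Real.log n)) := by gcongr
      _ = 2 * s * C * (R * Real.log (Real.log n)) := by ring
  · simp only [if_pos hlarge]
    have hsub : {e | ¬ (Q.lift (BroadcastLink.robustSim P code)).Succeeds P x e} ⊆
        {e | R / 16 + 1 ≤ (Finset.univ.filter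
          fun r : Fin (2 * R * s) => ¬ Q.Reliable (BroadcastLink.Gadget.block e r)).card} := by
      intro e he
      by_contra hlt
      refine he (Q.succeeds_lift (k := R / 16) (fun e' he' => ?_) ?_)
      · exact BroadcastLink.robustSim_succeeds P x e' hcode (by omega)
      · exact Nat.lt_succ_iff.1 (not_le.1 hlt)
    refine (measureReal_mono hsub (measure_ne_top _ _)).trans
      ((Q.measureReal_card_not_reliable_le _ hQ).trans ?_)
    have hn0 : (0 : ℝ) < n := by positivity
    have h4' : (4 : ℝ) ^ s ≤ n := by exact_mod_cast h4
    -- Since `16 * (R / 16 + 1) ≥ R + 1`, one factor `n⁻¹` is left after `4 ^ s ≤ n` has absorbed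
    -- the `2 ^ (2 * R * s)`. This also covers `R = 0`.
    calc (2 : ℝ) ^ (2 * R * s) * (((n : ℝ)⁻¹) ^ 16) ^ (R / 16 + 1)
        = ((4 : ℝ) ^ s) ^ R * ((n : ℝ)⁻¹) ^ (16 * (R / 16 + 1)) := by
          rw [← pow_mul (n : ℝ)⁻¹, ← pow_mul, mul_assoc, pow_mul, Nat.mul_comm R s]
          norm_num
      _ ≤ (n : ℝ) ^ R * ((n : ℝ)⁻¹) ^ (R + 1) := by
          refine mul_le_mul (by gcongr) ?_ (by positivity) (by positivity)
          refine pow_le_pow_of_le_one (by positivity) ?_ (by omega)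
          exact inv_le_one_of_one_le₀ (by exact_mod_cast (by omega : 1 ≤ n))
      _ = (n : ℝ)⁻¹ := by
          rw [pow_succ, ← mul_assoc, ← mul_pow, mul_inv_cancel₀ hn0.ne', one_pow, one_mul]
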